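/- **Setting.** Let $N\ge 1$ and $k>0$, and let $G_k$ be the fundamental solution of $\Delta^2+k^2$ on $\mathbb{R}^N$, that is, the integrable function, of class $C^2$ on $\mathbb{R}^N\setminus\{0\}$, with $$\int_{\mathbb{R}^N} G_k\,(\Delta^2\varphi+k^2\varphi)\,dx=\varphi(0)\qquad\text{for all }\varphi\in C_0^\infty(\mathbb{R}^N).$$ Explicitly, for $x\ne 0$, $$G_k(x)=\frac1k\,\operatorname{Im}\int_\Gamma e^{ikt}(4\pi t)^{-N/2}e^{-|x|^2/(4t)}\,dt,\qquad \Gamma=\{(1+i)s: s>0\}$$ (principal branch of the power). Write $(f*g)(x)=\int_{\mathbb{R}^N} f(z)\,g(x-z)\,dz$. **Theorem 4.2.** Let $\lambda=-k^2$ with $k>0$. Let $p$ be a real number with $1\le p\le 2$ and $p>\frac{2N}{N+4}$, and let $f\in L^p(\mathbb{R}^N)$ be real-valued. Then the function $G_k$ given by the explicit formula is the fundamental solution described above; the convolutions $$T_kf=f*G_k,\qquad S^i_kf=f*\partial_iG_k\ \ (1\le i\le N),\qquad S^\Delta_kf=f*\Delta G_k$$ (with $\partial_iG_k$ and $\Delta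 G_k$ the classical derivatives on $\mathbb{R}^N\setminus\{0\}$) converge absolutely for almost every $x$; and 1. $T_kf\in H^2(\mathbb{R}^N)$, i.e. $T_kf$ and its weak partial derivatives of orders one and two belong to $L^2(\mathbb{R}^N)$; 2. in the weak sense, $\partial_iT_kf=S^i_kf$ for $1\le i\le N$, and $\Delta T_kf=S^\Delta_kf$; 3. $u=T_kf$ is a weak solution of $\Delta^2u-\lambda u=f$, $u\in H^2(\mathbb{R}^N)$, i.e. $$\int_{\mathbb{R}^N}\big(\Delta u\,\Delta v-(\lambda u+f)\,v\big)\,dx=0\qquad\text{for all }v\in C_0^\infty(\mathbb{R}^N).$$ -/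

import Mathlib

open MeasureTheory
open scoped Laplacian

namespace Biharmonic

/-- `ℝ^N` with its Euclidean norm. -/
abbrev Space (N : ℕ) := EuclideanSpace ℝ (Fin N)

/-- Real test functions, i.e. the elements of `C₀^∞(ℝ^N)`. -/
def IsTest {N : ℕ} (φ : Space N → ℝ) : Prop :=
  ContDiff ℝ (⊤ : ℕ∞) φ ∧ HasCompactSupport φ

/-- The classical partial derivative `∂_i g`. -/
noncomputable def partialDeriv {N : ℕ} (i : Fin N) (g : Space N → ℝ) : Space N → ℝ :=
  fun x => fderiv ℝ g x (EuclideanSpace.single i 1)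

/-- The heat kernel `(4 π t)^{-N/2} exp (-|x|^2 / (4 t))` at a complex time `t`, `Re t > 0`
(principal branch of the power). -/
noncomputable def heatKernel {N : ℕ} (t : ℂ) (x : Space N) : ℂ :=
  (4 * (Real.pi : ℂ) * t) ^ (-((N : ℂ) / 2)) * Complex.exp (-(((‖x‖ ^ 2 : ℝ) : ℂ) / (4 * t)))

/-- The fundamental solution `G_k` of `Δ² + k²` on `ℝ^N`, `k > 0`.
As `1 / (|ξ|⁴ + k²) = k⁻¹ Im (1 / (|ξ|² - i k))` and
`1 / (|ξ|² - i k) = ∫ exp (-(|ξ|² - i k) t) dt` along the ray `t = (1 + i) s`, `s > 0`,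
one has `G_k(x) = k⁻¹ Im ∫ exp (i k t) (4 π t)^{-N/2} exp (-|x|² / (4 t)) dt` along that ray. The
integral converges absolutely for every `x ≠ 0`. -/
noncomputable def greenFn {N : ℕ} (k : ℝ) (x : Space N) : ℝ :=
  k⁻¹ * (∫ s in Set.Ioi (0 : ℝ),
    (1 + Complex.I) * Complex.exp (Complex.I * k * ((1 + Complex.I) * s)) *
      heatKernel ((1 + Complex.I) * s) x).im

/-- `G` is the fundamental solution of `Δ² + k²`: an integrable function, twice continuously
differentiable off the origin, with `Δ² G + k² G = δ₀` in the sense of distributions.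
Integrability makes it unique almost everywhere, and continuity then makes it unique at
every `x ≠ 0`. -/
structure IsFundamentalSolution {N : ℕ} (k : ℝ) (G : Space N → ℝ) : Prop where
  integrable : Integrable G volume
  contDiffOn : ContDiffOn ℝ 2 G {0}ᶜ
  eq_dirac : ∀ φ : Space N → ℝ, IsTest φ →
    ∫ x, G x * (Δ (Δ φ) x + k ^ 2 * φ x) = φ 0

/-- The convolution `(f * g)(x) = ∫ f(z) g(x - z) dz`. -/
noncomputable def conv {N : ℕ} (f g : Space N → ℝ) : Space N → ℝ :=
  convolution f g (ContinuousLinearMap.mul ℝ ℝ) volume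

/-- The integral defining `(f * g)(x)` converges absolutely for almost every `x`. -/
def ConvExistsAE {N : ℕ} (f g : Space N → ℝ) : Prop :=
  ∀ᵐ x : Space N, ConvolutionExistsAt f g x (ContinuousLinearMap.mul ℝ ℝ) volume

/-- `T_k f = f * G_k`. -/
noncomputable def opT {N : ℕ} (k : ℝ) (f : Space N → ℝ) : Space N → ℝ :=
  conv f (greenFn k)

/-- `S^i_k f = f * ∂_i G_k`. -/
noncomputable def opS {N : ℕ} (k : ℝ) (i : Fin N) (f : Space N → ℝ) : Space N → ℝ :=
  conv f (partialDeriv i (greenFn k))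

/-- `S^Δ_k f = f * Δ G_k`. -/
noncomputable def opSLap {N : ℕ} (k : ℝ) (f : Space N → ℝ) : Space N → ℝ :=
  conv f (Δ (greenFn k))

/-- `v` is the weak partial derivative `∂_i u`. -/
def HasWeakPartialDeriv {N : ℕ} (i : Fin N) (u v : Space N → ℝ) : Prop :=
  LocallyIntegrable u volume ∧ LocallyIntegrable v volume ∧
    ∀ φ : Space N → ℝ, IsTest φ → ∫ x, u x * partialDeriv i φ x = -∫ x, v x * φ x

/-- `v` is the weak Laplacian `Δ u`. -/
def HasWeakLaplacian {N : ℕ} (u v : Space N → ℝ) : Prop :=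
  LocallyIntegrable u volume ∧ LocallyIntegrable v volume ∧
    ∀ φ : Space N → ℝ, IsTest φ → ∫ x, u x * Δ φ x = ∫ x, v x * φ x

/-- `u ∈ H²(ℝ^N)`: `u` and its weak partial derivatives of orders one and two are in `L²`. -/
def MemH2 {N : ℕ} (u : Space N → ℝ) : Prop :=
  MemLp u 2 volume ∧ ∀ i : Fin N, ∃ v : Space N → ℝ,
    MemLp v 2 volume ∧ HasWeakPartialDeriv i u v ∧
      ∀ j : Fin N, ∃ w : Space N → ℝ, MemLp w 2 volume ∧ HasWeakPartialDeriv j v w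

/-- `u` is a weak solution of `Δ² u - lam u = f`, `u ∈ H²(ℝ^N)`:
`∫ Δu Δφ - (lam u + f) φ = 0` for all test functions `φ`, where `w` below is the weak
Laplacian `Δu`. -/
def IsWeakSolution {N : ℕ} (lam : ℝ) (f u : Space N → ℝ) : Prop :=
  MemH2 u ∧ ∃ w : Space N → ℝ, MemLp w 2 volume ∧ HasWeakLaplacian u w ∧
    ∀ φ : Space N → ℝ, IsTest φ → ∫ x, (w x * Δ φ x - (lam * u x + f x) * φ x) = 0

end Biharmonic

/-! The fourth-order problem reduces to a second-order complex one. Since `1 / (|ξ|⁴ + k²) = k⁻¹ Im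
(1 / (|ξ|² - i k))`, the function `G_k` equals `k⁻¹ Im K`, where `K` is the kernel of `(-Δ - i
k)⁻¹`. This `K` is the integral of `exp (i k t)` times the heat kernel over the ray `t = (1 + i) s`:
rotating the time axis by 45 degrees makes `exp (i k t)` decay like `exp (-k s)` and keeps the heat
kernel Gaussian.

Off the origin `ΔK = -i k K`, hence `ΔG_k = -Re K`. So `G_k` and `ΔG_k` obey the same bounds, those
of `K`, and `K` lies in `L^q` as soon as `N/2 - N/(2q) < 1` (`memLp_resolventKernel`). With `1/p +
1/q = 3/2` this condition is exactly `p > 2N/(N+4)`, and Young's inequality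
(`lintegral_absConv_rpow_lt_top`) puts `T_k f` and `S^Δ_k f` in `L²`. The kernel `∂_i G_k` is
integrable, so `S^i_k f` lies in `L^p`.

The identity `(-Δ - i k) K = δ₀` (`integral_resolventKernel_mul`) is proved on the Fourier side,
where the ray integral is the reciprocal of the symbol. Against real test functions its imaginary
part says that `ΔG_k` is the distributional Laplacian of `G_k`, and its real part that `Δ(ΔG_k) + k²
G_k = δ₀`. Fubini (`integral_conv_mul`) carries these identities over to convolutions with `f`.
Finally, `u` and `Δu` in `L²` give `u ∈ H²` through the Bessel potential of order two
(`memH2_of_laplacian`). -/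

namespace Biharmonic

/-! ### The integrand along the ray and its real majorant -/

open Complex in
/-- The `m`-th derivative in `ρ = |x|²` of the integrand of the kernel of `(-Δ - i k)⁻¹`. -/
noncomputable def resolventIntegrand (N : ℕ) (k : ℝ) (m : ℕ) (ρ s : ℝ) : ℂ :=
  (-1 / (4 * ((1 + I) * s))) ^ m * ((1 + I) * cexp (I * k * ((1 + I) * s)) *
    ((4 * (Real.pi : ℂ) * ((1 + I) * s)) ^ (-((N : ℂ) / 2)) *
      cexp (-((ρ : ℂ) / (4 * ((1 + I) * s))))))

/-- The real function bounding the integrands. -/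
noncomputable def majorantIntegrand (k a c ρ s : ℝ) : ℝ :=
  Real.exp (-k * s) * s ^ (-a) * Real.exp (-(ρ / (c * s)))

lemma majorantIntegrand_nonneg (k a c ρ : ℝ) {s : ℝ} (hs : 0 < s) :
    0 ≤ majorantIntegrand k a c ρ s := by
  unfold majorantIntegrand; positivity

/-- The constant relating `resolventIntegrand` and `majorantIntegrand`. -/
noncomputable def resolventConst (N m : ℕ) : ℝ :=
  ((4 * √2) ^ m)⁻¹ * (√2 * (4 * Real.pi * √2) ^ (-((N : ℝ) / 2)))

lemma norm_one_add_I : ‖(1 + Complex.I : ℂ)‖ = √2 := by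
  rw [Complex.norm_def]
  norm_num [Complex.normSq_apply]

lemma ray_ne_zero {s : ℝ} (hs : 0 < s) : ((1 + Complex.I) * s : ℂ) ≠ 0 := by
  refine mul_ne_zero ?_ (by exact_mod_cast hs.ne')
  rw [← norm_ne_zero_iff, norm_one_add_I]
  positivity

lemma inv_one_add_I : ((1 + Complex.I : ℂ))⁻¹ = (1 - Complex.I) / 2 := by
  refine inv_eq_of_mul_eq_one_right ?_
  ring_nf
  rw [Complex.I_sq]; norm_num

/-- As `1 / (1 + i) = (1 - i) / 2`, the Gaussian survives on the ray with half its rate; this is the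
source of the constant 8 in the majorants. -/
lemma ray_div_re (ρ : ℝ) (s : ℝ) :
    ((ρ : ℂ) / (4 * ((1 + Complex.I) * s))).re = ρ / (8 * s) := by
  have : (ρ : ℂ) / (4 * ((1 + Complex.I) * s)) = ((ρ / (8 * s) : ℝ) : ℂ) * (1 - Complex.I) := by
    rw [div_eq_mul_inv, mul_inv, mul_inv, inv_one_add_I]
    push_cast
    ring
  rw [this, Complex.re_ofReal_mul]
  simp

/-- The exponent of the complex power is real, so its argument does not affect the modulus. Each
derivative in `ρ` costs one factor `s⁻¹`, whence the exponent `N/2 + m`. -/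
lemma norm_resolventIntegrand (N : ℕ) (k : ℝ) (m : ℕ) (ρ : ℝ) {s : ℝ} (hs : 0 < s) :
    ‖resolventIntegrand N k m ρ s‖ =
      resolventConst N m * majorantIntegrand k ((N : ℝ) / 2 + m) 8 ρ s := by
  have hcs : ‖((1 + Complex.I) * s : ℂ)‖ = √2 * s := by
    rw [norm_mul, norm_one_add_I, Complex.norm_real, Real.norm_of_nonneg hs.le]
  have h1 : ‖((4 * (Real.pi : ℂ) * ((1 + Complex.I) * s)) ^ (-((N : ℂ) / 2)))‖ =
      (4 * Real.pi * √2) ^ (-((N : ℝ) / 2)) * s ^ (-((N : ℝ) / 2)) := by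
    have : (-((N : ℂ) / 2)) = ((-((N : ℝ) / 2) : ℝ) : ℂ) := by push_cast; rfl
    rw [this, Complex.norm_cpow_real, norm_mul, hcs, norm_mul, Complex.norm_real,
      Real.norm_of_nonneg Real.pi_pos.le, ← Real.mul_rpow (by positivity) hs.le]
    norm_num [mul_assoc]
  have h2 : ‖Complex.exp (-((ρ : ℂ) / (4 * ((1 + Complex.I) * s))))‖ =
      Real.exp (-(ρ / (8 * s))) := by
    rw [Complex.norm_exp, Complex.neg_re, ray_div_re]
  have h3 : ‖Complex.exp (Complex.I * k * ((1 + Complex.I) * s))‖ = Real.exp (-k * s) := by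
    rw [Complex.norm_exp]
    simp
  have h4 : ‖(-1 / (4 * ((1 + Complex.I) * s) : ℂ)) ^ m‖ = ((4 * √2) ^ m)⁻¹ * s ^ (-(m : ℝ)) := by
    rw [norm_pow, norm_div, norm_mul, hcs, div_pow, Real.rpow_neg hs.le, Real.rpow_natCast]
    simp only [norm_neg, norm_one, Complex.norm_ofNat, mul_pow, mul_inv]
    ring
  unfold resolventIntegrand resolventConst majorantIntegrand
  rw [norm_mul, norm_mul, norm_mul, norm_mul, h1, h2, h3, h4, norm_one_add_I, neg_add,
    Real.rpow_add hs]
  ring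

/-- `s ^ (-a) exp (-b / s)` is bounded on `(0, ∞)`. -/
lemma rpow_neg_mul_exp_le {a b s : ℝ} (ha : 0 ≤ a) (hb : 0 < b) (hs : 0 < s) :
    s ^ (-a) * Real.exp (-(b / s)) ≤ ((a + 1) / b) ^ a := by
  have ha1 : 0 < a + 1 := by linarith
  -- The inequality `y ≤ exp y` will be raised to the power `a`. Dividing by `a + 1` instead of `a`
  -- covers `a = 0`.
  have h1 : b / (s * (a + 1)) ≤ Real.exp (b / (s * (a + 1))) := by
    linarith [Real.add_one_le_exp (b / (s * (a + 1)))]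
  have h2 : (b / (s * (a + 1))) ^ a ≤ Real.exp (b / s) := by
    calc (b / (s * (a + 1))) ^ a ≤ Real.exp (b / (s * (a + 1))) ^ a := by gcongr
      _ = Real.exp (b / (s * (a + 1)) * a) := by rw [← Real.exp_mul]
      _ ≤ Real.exp (b / s) := by
        apply Real.exp_le_exp.2
        have : b / (s * (a + 1)) * a = b / s * (a / (a + 1)) := by field_simp
        rw [this]
        apply mul_le_of_le_one_right (by positivity)
        rw [div_le_one ha1]; linarith
  have h3 : s ^ (-a) = (b / (s * (a + 1))) ^ a * ((a + 1) / b) ^ a := by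
    rw [← Real.mul_rpow (by positivity) (by positivity), Real.rpow_neg hs.le,
      ← Real.inv_rpow hs.le]
    congr 1
    field_simp
  rw [h3, Real.exp_neg, mul_right_comm]
  apply mul_le_of_le_one_left (by positivity)
  rw [← div_eq_mul_inv]
  exact div_le_one_of_le₀ h2 (Real.exp_pos _).le

lemma majorantIntegrand_le {k a c ρ₀ ρ s : ℝ} (ha : 0 ≤ a) (hc : 0 < c) (hρ₀ : 0 < ρ₀)
    (hρ : ρ₀ ≤ ρ) (hs : 0 < s) :
    majorantIntegrand k a c ρ s ≤ Real.exp (-k * s) * ((a + 1) / (ρ₀ / c)) ^ a := by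
  unfold majorantIntegrand
  rw [mul_assoc]
  gcongr
  refine le_trans ?_ (rpow_neg_mul_exp_le ha (div_pos hρ₀ hc) hs)
  refine mul_le_mul_of_nonneg_left (Real.exp_le_exp.2 (neg_le_neg ?_)) (by positivity)
  rw [div_div]
  exact div_le_div_of_nonneg_right hρ (by positivity)

lemma measurable_resolventIntegrand (N : ℕ) (k : ℝ) (m : ℕ) (ρ : ℝ) :
    Measurable (resolventIntegrand N k m ρ) := by
  unfold resolventIntegrand
  fun_prop

lemma resolventConst_nonneg (N m : ℕ) : 0 ≤ resolventConst N m := by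
  unfold resolventConst; positivity

/-- The bound of the integrand for `ρ ≥ ρ₀`. -/
noncomputable def awayBound (N m : ℕ) (ρ₀ : ℝ) : ℝ :=
  resolventConst N m * ((((N : ℝ) / 2 + m) + 1) / (ρ₀ / 8)) ^ ((N : ℝ) / 2 + m)

lemma norm_resolventIntegrand_le {N : ℕ} {k : ℝ} {m : ℕ} {ρ₀ ρ s : ℝ} (hρ₀ : 0 < ρ₀)
    (hρ : ρ₀ ≤ ρ) (hs : 0 < s) :
    ‖resolventIntegrand N k m ρ s‖ ≤ awayBound N m ρ₀ * Real.exp (-k * s) := by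
  rw [norm_resolventIntegrand _ _ _ _ hs, awayBound, mul_assoc]
  refine mul_le_mul_of_nonneg_left ?_ (resolventConst_nonneg N m)
  rw [mul_comm]
  exact majorantIntegrand_le (by positivity) (by norm_num) hρ₀ hρ hs

lemma integrableOn_awayBound {k : ℝ} (hk : 0 < k) (N m : ℕ) (ρ₀ : ℝ) :
    IntegrableOn (fun s => awayBound N m ρ₀ * Real.exp (-k * s)) (Set.Ioi 0) :=
  (exp_neg_integrableOn_Ioi 0 hk).const_mul _

lemma integrableOn_resolventIntegrand {N : ℕ} {k : ℝ} (hk : 0 < k) (m : ℕ) {ρ : ℝ} (hρ : 0 < ρ) :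
    IntegrableOn (resolventIntegrand N k m ρ) (Set.Ioi 0) := by
  refine (integrableOn_awayBound hk N m ρ).mono'
    (measurable_resolventIntegrand N k m ρ).aestronglyMeasurable ?_
  filter_upwards [ae_restrict_mem measurableSet_Ioi] with s hs
  exact norm_resolventIntegrand_le hρ le_rfl hs

lemma hasDerivAt_resolventIntegrand (N : ℕ) (k : ℝ) (m : ℕ) (ρ s : ℝ) :
    HasDerivAt (fun ρ => resolventIntegrand N k m ρ s) (resolventIntegrand N k (m + 1) ρ s) ρ := by
  unfold resolventIntegrand
  have h : HasDerivAt (fun ρ : ℝ => Complex.exp (-((ρ : ℂ) / (4 * ((1 + Complex.I) * s)))))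
      (Complex.exp (-((ρ : ℂ) / (4 * ((1 + Complex.I) * s)))) *
        (-(1 / (4 * ((1 + Complex.I) * s))))) ρ :=
    (((hasDerivAt_id (ρ : ℂ)).div_const _).neg.cexp).comp_ofReal
  refine (((h.const_mul ((4 * (Real.pi : ℂ) * ((1 + Complex.I) * s)) ^ (-((N : ℂ) / 2)))).const_mul
    ((1 + Complex.I) * Complex.exp (Complex.I * k * ((1 + Complex.I) * s)))).const_mul
    ((-1 / (4 * ((1 + Complex.I) * s))) ^ m)).congr_deriv ?_
  rw [pow_succ]
  ring

/-! ### The radial profile and its differential equation -/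

/-- The `m`-th derivative of the profile of the kernel of `(-Δ - i k)⁻¹`, in the variable `|x|²`. -/
noncomputable def resolventProfile (N : ℕ) (k : ℝ) (m : ℕ) (ρ : ℝ) : ℂ :=
  ∫ s in Set.Ioi (0 : ℝ), resolventIntegrand N k m ρ s

lemma hasDerivAt_resolventProfile {N : ℕ} {k : ℝ} (hk : 0 < k) (m : ℕ) {ρ : ℝ} (hρ : 0 < ρ) :
    HasDerivAt (resolventProfile N k m) (resolventProfile N k (m + 1) ρ) ρ := by
  refine (hasDerivAt_integral_of_dominated_loc_of_deriv_le (𝕜 := ℝ)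
    (bound := fun s => awayBound N (m + 1) (ρ / 2) * Real.exp (-k * s))
    (F := resolventIntegrand N k m) (F' := resolventIntegrand N k (m + 1))
    -- The domination is uniform on the neighbourhood `(ρ/2, ∞)` of `ρ`, where the Gaussian keeps
    -- `s` away from the singularity at 0.
    (Ioi_mem_nhds (half_lt_self hρ)) ?_ (integrableOn_resolventIntegrand hk m hρ)
    (measurable_resolventIntegrand N k _ ρ).aestronglyMeasurable ?_
    (integrableOn_awayBound hk _ _ _) ?_).2
  · exact Filter.Eventually.of_forall fun ρ =>
      (measurable_resolventIntegrand N k _ ρ).aestronglyMeasurable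
  · filter_upwards [ae_restrict_mem measurableSet_Ioi] with s hs ρ' hρ'
    exact norm_resolventIntegrand_le (by positivity) (le_of_lt hρ') hs
  · exact Filter.Eventually.of_forall fun s ρ' _ => hasDerivAt_resolventIntegrand N k m ρ' s

/-- This is the heat equation: in the variable `ρ = |x|²` the Laplacian is `4ρ ∂² + 2N ∂`. The term
`i k` comes from differentiating `exp (i k t)`, and `1 + i` is `dt/ds`. -/
lemma hasDerivAt_resolventIntegrand_time (N : ℕ) (k : ℝ) (ρ : ℝ) {s : ℝ} (hs : 0 < s) :
    HasDerivAt (resolventIntegrand N k 0 ρ)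
      ((1 + Complex.I) * (4 * ρ * resolventIntegrand N k 2 ρ s +
        2 * N * resolventIntegrand N k 1 ρ s + Complex.I * k * resolventIntegrand N k 0 ρ s)) s := by
  have hτ := ray_ne_zero hs
  have hmem : 4 * (Real.pi : ℂ) * ((1 + Complex.I) * s) ∈ Complex.slitPlane := by
    left
    have : (4 * (Real.pi : ℂ) * ((1 + Complex.I) * s)).re = 4 * Real.pi * s := by simp
    rw [this]; positivity
  have hray : HasDerivAt (fun s : ℝ => (1 + Complex.I) * (s : ℂ)) (1 + Complex.I) s := by
    simpa using ((hasDerivAt_id (s : ℂ)).const_mul (1 + Complex.I)).comp_ofReal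
  have h1 := (hray.const_mul (Complex.I * k)).cexp
  have h2 : HasDerivAt (fun s : ℝ => (4 * (Real.pi : ℂ) * ((1 + Complex.I) * s)) ^ (-((N : ℂ) / 2)))
      ((-((N : ℂ) / 2)) * (4 * (Real.pi : ℂ) * ((1 + Complex.I) * s)) ^ (-((N : ℂ) / 2) - 1) *
        (4 * (Real.pi : ℂ) * (1 + Complex.I))) s := by
    have hc : HasDerivAt (fun z : ℂ => 4 * (Real.pi : ℂ) * ((1 + Complex.I) * z))
        (4 * (Real.pi : ℂ) * (1 + Complex.I)) (s : ℂ) := by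
      simpa using ((hasDerivAt_id (s : ℂ)).const_mul (1 + Complex.I)).const_mul (4 * (Real.pi : ℂ))
    exact (hc.cpow_const hmem).comp_ofReal
  have h3 := ((hasDerivAt_const s (ρ : ℂ)).fun_div (hray.const_mul 4)
    (mul_ne_zero (by norm_num) hτ)).fun_neg.cexp
  have h := ((h1.const_mul (1 + Complex.I)).fun_mul (h2.fun_mul h3)).const_mul
    ((-1 / (4 * ((1 + Complex.I) * s))) ^ 0)
  simp only [pow_zero] at h
  have hfun : resolventIntegrand N k 0 ρ = fun s : ℝ => 1 * ((1 + Complex.I) *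
      Complex.exp (Complex.I * k * ((1 + Complex.I) * s)) *
    ((4 * (Real.pi : ℂ) * ((1 + Complex.I) * s)) ^ (-((N : ℂ) / 2)) *
      Complex.exp (-((ρ : ℂ) / (4 * ((1 + Complex.I) * s)))))) := by
    ext s; simp [resolventIntegrand]
  rw [hfun]
  refine h.congr_deriv ?_
  rw [← hfun]
  unfold resolventIntegrand
  rw [Complex.cpow_sub _ _ (mul_ne_zero (by simp [Real.pi_ne_zero]) hτ), Complex.cpow_one]
  generalize Complex.exp (Complex.I * k * ((1 + Complex.I) * s)) = A
  generalize (4 * (Real.pi : ℂ) * ((1 + Complex.I) * s)) ^ (-((N : ℂ) / 2)) = B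
  generalize Complex.exp (-((ρ : ℂ) / (4 * ((1 + Complex.I) * s)))) = C
  have hs' : (s : ℂ) ≠ 0 := by exact_mod_cast hs.ne'
  have hc : (1 + Complex.I : ℂ) ≠ 0 := left_ne_zero_of_mul hτ
  generalize (1 + Complex.I : ℂ) = c at *
  have hpi : (Real.pi : ℂ) ≠ 0 := by exact_mod_cast Real.pi_ne_zero
  field_simp
  ring

open Filter Topology in
/-- The radial form of `ΔK = -i k K`. -/
lemma resolventProfile_ode {N : ℕ} {k : ℝ} (hk : 0 < k) {ρ : ℝ} (hρ : 0 < ρ) :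
    4 * ρ * resolventProfile N k 2 ρ + 2 * N * resolventProfile N k 1 ρ =
      -(Complex.I * k * resolventProfile N k 0 ρ) := by
  have hi := fun m => integrableOn_resolventIntegrand (N := N) hk m hρ
  -- Using the majorant with `N/2 + 1` instead of `N/2` leaves a spare factor `s`, which makes the
  -- boundary term at `s = 0` vanish.
  have hbound : ∀ s, 0 < s → ‖resolventIntegrand N k 0 ρ s‖ ≤
      resolventConst N 0 * ((((N : ℝ) / 2 + 1) + 1) / (ρ / 8)) ^ ((N : ℝ) / 2 + 1) *
        (Real.exp (-k * s) * s) := by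
    intro s hs
    rw [norm_resolventIntegrand _ _ _ _ hs, mul_assoc]
    refine mul_le_mul_of_nonneg_left ?_ (resolventConst_nonneg N 0)
    have h := majorantIntegrand_le (k := k) (a := (N : ℝ) / 2 + 1) (c := 8) (by positivity)
      (by norm_num) hρ le_rfl hs
    have h' : majorantIntegrand k ((N : ℝ) / 2 + (0 : ℕ)) 8 ρ s =
        majorantIntegrand k ((N : ℝ) / 2 + 1) 8 ρ s * s := by
      unfold majorantIntegrand
      rw [neg_add _ (1 : ℝ), Real.rpow_add hs, Real.rpow_neg_one]
      field_simp
      simp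
    rw [h']
    calc _ ≤ _ := mul_le_mul_of_nonneg_right h hs.le
      _ = _ := by ring
  have hexp : Tendsto (fun s : ℝ => Real.exp (-k * s) * s) atTop (𝓝 0) := by
    have := tendsto_rpow_mul_exp_neg_mul_atTop_nhds_zero 1 k hk
    simpa [mul_comm] using this
  -- The time derivative is integrated over the ray. Both boundary terms are 0; the extension by 0
  -- fixes the endpoint value.
  have key := integral_Ioi_of_hasDerivAt_of_tendsto
    (f := fun s => if 0 < s then resolventIntegrand N k 0 ρ s else 0)
    (f' := fun s => (1 + Complex.I) * (4 * ρ * resolventIntegrand N k 2 ρ s +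
        2 * N * resolventIntegrand N k 1 ρ s + Complex.I * k * resolventIntegrand N k 0 ρ s))
    (a := 0) (m := 0) ?_ ?_ ?_ ?_
  · rw [integral_const_mul, integral_add, integral_add, integral_const_mul, integral_const_mul,
      integral_const_mul] at key
    · simp only [lt_irrefl, if_false, sub_zero, mul_eq_zero] at key
      have := key.resolve_left (left_ne_zero_of_mul (ray_ne_zero one_pos))
      exact eq_neg_of_add_eq_zero_left this
    · exact (hi 2).const_mul _
    · exact (hi 1).const_mul _
    · exact ((hi 2).const_mul _).add ((hi 1).const_mul _)
    · exact (hi 0).const_mul _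
  · rw [ContinuousWithinAt, if_neg (lt_irrefl _)]
    apply squeeze_zero_norm' (a := fun s => resolventConst N 0 *
      ((((N : ℝ) / 2 + 1) + 1) / (ρ / 8)) ^ ((N : ℝ) / 2 + 1) * (Real.exp (-k * s) * s))
    · filter_upwards [self_mem_nhdsWithin] with s hs
      split_ifs with h
      · exact hbound s h
      · have : s = 0 := le_antisymm (not_lt.1 h) hs
        simp [this]
    · have : Continuous fun s : ℝ => resolventConst N 0 *
        ((((N : ℝ) / 2 + 1) + 1) / (ρ / 8)) ^ ((N : ℝ) / 2 + 1) * (Real.exp (-k * s) * s) := by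
        fun_prop
      simpa using (this.tendsto 0).mono_left nhdsWithin_le_nhds
  · intro s hs
    refine (hasDerivAt_resolventIntegrand_time N k ρ hs).congr_of_eventuallyEq ?_
    filter_upwards [Ioi_mem_nhds hs] with s hs
    exact if_pos hs
  · exact ((((hi 2).const_mul _).add ((hi 1).const_mul _)).add ((hi 0).const_mul _)).const_mul _
  · apply squeeze_zero_norm' (a := fun s => resolventConst N 0 *
      ((((N : ℝ) / 2 + 1) + 1) / (ρ / 8)) ^ ((N : ℝ) / 2 + 1) * (Real.exp (-k * s) * s))
    · filter_upwards [eventually_gt_atTop 0] with s hs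
      rw [if_pos hs]
      exact hbound s hs
    · simpa using hexp.const_mul _

/-! ### The kernels off the origin -/

/-- The kernel of `(-Δ - i k)⁻¹`, so that `greenFn k = k⁻¹ Im (resolventKernel k)`. -/
noncomputable def resolventKernel {N : ℕ} (k : ℝ) (x : Space N) : ℂ :=
  resolventProfile N k 0 (‖x‖ ^ 2)

/-- The real linear map `z ↦ k⁻¹ Im z`. -/
noncomputable def scaledIm (k : ℝ) : ℂ →L[ℝ] ℝ := k⁻¹ • Complex.imCLM

lemma scaledIm_apply (k : ℝ) (z : ℂ) : scaledIm k z = k⁻¹ * z.im := rfl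

lemma greenFn_eq_scaledIm_comp {N : ℕ} (k : ℝ) :
    greenFn (N := N) k = scaledIm k ∘ resolventKernel k := by
  ext x
  rw [Function.comp_apply, scaledIm_apply, greenFn, resolventKernel, resolventProfile]
  simp [resolventIntegrand, heatKernel]

/-- The induction on `n` runs over all `m` at once, since differentiating the profile raises `m` by
one. -/
lemma contDiffOn_resolventProfile {N : ℕ} {k : ℝ} (hk : 0 < k) (n : ℕ) :
    ∀ m, ContDiffOn ℝ n (resolventProfile N k m) (Set.Ioi 0) := by
  induction n with
  | zero =>
    intro m
    exact contDiffOn_zero.2 fun ρ hρ =>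
      (hasDerivAt_resolventProfile hk m hρ).continuousAt.continuousWithinAt
  | succ n ih =>
    intro m
    push_cast
    rw [contDiffOn_succ_iff_deriv_of_isOpen isOpen_Ioi]
    refine ⟨fun ρ hρ => (hasDerivAt_resolventProfile hk m hρ).differentiableAt.differentiableWithinAt,
      by simp, (ih (m + 1)).congr fun ρ hρ => (hasDerivAt_resolventProfile hk m hρ).deriv⟩

lemma contDiffOn_resolventKernel {N : ℕ} {k : ℝ} (hk : 0 < k) (n : ℕ) :
    ContDiffOn ℝ n (resolventKernel (N := N) k) {0}ᶜ := by
  refine (contDiffOn_resolventProfile hk n 0).comp (contDiff_norm_sq ℝ).contDiffOn ?_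
  intro x hx
  have : x ≠ 0 := hx
  exact Set.mem_Ioi.2 (by positivity)

lemma contDiffAt_resolventKernel {N : ℕ} {k : ℝ} (hk : 0 < k) (n : ℕ) {x : Space N} (hx : x ≠ 0) :
    ContDiffAt ℝ n (resolventKernel k) x :=
  (contDiffOn_resolventKernel hk n).contDiffAt (isOpen_compl_singleton.mem_nhds hx)

lemma contDiffOn_greenFn {N : ℕ} {k : ℝ} (hk : 0 < k) (n : ℕ) :
    ContDiffOn ℝ n (greenFn (N := N) k) {0}ᶜ := by
  rw [greenFn_eq_scaledIm_comp]
  exact (scaledIm k).contDiff.comp_contDiffOn (contDiffOn_resolventKernel hk n)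

/-- Derivative of a radial function written in the variable `|x|²`. -/
lemma hasFDerivAt_comp_norm_sq {E F : Type*} [NormedAddCommGroup E] [InnerProductSpace ℝ E]
    [NormedAddCommGroup F] [NormedSpace ℝ F] {P : ℝ → F} {P' : F} {x : E}
    (h : HasDerivAt P P' (‖x‖ ^ 2)) :
    HasFDerivAt (fun y => P (‖y‖ ^ 2)) ((2 • innerSL ℝ x).smulRight P') x := by
  refine ((h.hasFDerivAt).comp x (hasStrictFDerivAt_norm_sq x).hasFDerivAt).congr_fderiv ?_
  ext v
  simp [two_smul, add_smul]

lemma fderiv_resolventKernel_apply {N : ℕ} {k : ℝ} (hk : 0 < k) {x : Space N} (hx : x ≠ 0)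
    (v : Space N) :
    fderiv ℝ (resolventKernel k) x v = (2 * inner ℝ x v) • resolventProfile N k 1 (‖x‖ ^ 2) := by
  have h := hasFDerivAt_comp_norm_sq (x := x)
    (hasDerivAt_resolventProfile (N := N) hk 0 (ρ := ‖x‖ ^ 2) (by positivity))
  have h' : HasFDerivAt (resolventKernel k) _ x := h
  rw [h'.fderiv]
  simp

/-- A radial function satisfies `Δ P(|x|²) = 2N P' + 4|x|² P''`, so the claim is the profile
equation. The coordinate sum uses `∑ ⟨x, e_i⟩² = |x|²`. -/
lemma laplacian_resolventKernel {N : ℕ} {k : ℝ} (hk : 0 < k) {x : Space N} (hx : x ≠ 0) :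
    Δ (resolventKernel k) x = -(Complex.I * k * resolventKernel k x) := by
  have hpos : 0 < ‖x‖ ^ 2 := by positivity
  have key : ∀ i : Fin N, iteratedFDeriv ℝ 2 (resolventKernel k) x
      ![EuclideanSpace.basisFun (Fin N) ℝ i, EuclideanSpace.basisFun (Fin N) ℝ i] =
      2 * resolventProfile N k 1 (‖x‖ ^ 2) +
        ((4 * inner ℝ x (EuclideanSpace.basisFun (Fin N) ℝ i) ^ 2 : ℝ) : ℂ) *
          resolventProfile N k 2 (‖x‖ ^ 2) := by
    intro i
    set e := EuclideanSpace.basisFun (Fin N) ℝ i with he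
    rw [iteratedFDeriv_two_apply]
    simp only [Matrix.cons_val_zero, Matrix.cons_val_one]
    have hd : DifferentiableAt ℝ (fderiv ℝ (resolventKernel (N := N) k)) x :=
      ((contDiffAt_resolventKernel hk 2 hx).fderiv_right (m := 1) (by norm_num)).differentiableAt
        (by norm_num)
    have h1 : fderiv ℝ (fun y => fderiv ℝ (resolventKernel (N := N) k) y e) x e =
        fderiv ℝ (fderiv ℝ (resolventKernel k)) x e e := by
      rw [fderiv_clm_apply hd (differentiableAt_const e)]
      simp
    have h2 : (fun y => fderiv ℝ (resolventKernel (N := N) k) y e) =ᶠ[nhds x]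
        fun y => (2 * inner ℝ y e) • resolventProfile N k 1 (‖y‖ ^ 2) := by
      filter_upwards [isOpen_compl_singleton.mem_nhds hx] with y hy
      exact fderiv_resolventKernel_apply hk hy e
    have h3 : HasFDerivAt (fun y : Space N => 2 * inner ℝ y e) ((2 : ℝ) • (innerSL ℝ e)) x := by
      have := ((innerSL ℝ e).hasFDerivAt (x := x)).const_mul (2 : ℝ)
      simpa [real_inner_comm] using this
    have h4 := h3.fun_smul (hasFDerivAt_comp_norm_sq (x := x)
      (hasDerivAt_resolventProfile (N := N) hk 1 hpos))
    have hee : ‖e‖ = 1 := (EuclideanSpace.basisFun (Fin N) ℝ).orthonormal.1 i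
    rw [← h1, h2.fderiv_eq, h4.fderiv]
    simp [hee]
    ring
  rw [InnerProductSpace.laplacian_eq_iteratedFDeriv_orthonormalBasis _
    (EuclideanSpace.basisFun (Fin N) ℝ)]
  simp only [key]
  rw [Finset.sum_add_distrib, Finset.sum_const, ← Finset.sum_mul, ← Complex.ofReal_sum, ← Finset.mul_sum,
    OrthonormalBasis.sum_sq_inner_left, Finset.card_univ, Fintype.card_fin,
    nsmul_eq_mul, resolventKernel, ← resolventProfile_ode hk hpos]
  push_cast
  ring

/-- The imaginary part of `-i k K` is `-k Re K`, and `k⁻¹` cancels `k`. Every estimate for `K` thus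
serves `ΔG_k` as well as `G_k`. -/
lemma laplacian_greenFn {N : ℕ} {k : ℝ} (hk : 0 < k) {x : Space N} (hx : x ≠ 0) :
    Δ (greenFn k) x = -(resolventKernel k x).re := by
  rw [greenFn_eq_scaledIm_comp,
    (contDiffAt_resolventKernel hk 2 hx).laplacian_CLM_comp_left, Function.comp_apply,
    laplacian_resolventKernel hk hx, scaledIm_apply]
  have : (-(Complex.I * k * resolventKernel k x)).im = -(k * (resolventKernel k x).re) := by
    simp
  rw [this]
  field_simp

lemma partialDeriv_greenFn {N : ℕ} {k : ℝ} (hk : 0 < k) (i : Fin N) {x : Space N} (hx : x ≠ 0) :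
    partialDeriv i (greenFn k) x =
      scaledIm k ((2 * x i) • resolventProfile N k 1 (‖x‖ ^ 2)) := by
  have hd := (contDiffAt_resolventKernel hk 2 hx).differentiableAt (by norm_num)
  rw [partialDeriv, greenFn_eq_scaledIm_comp, fderiv_comp x (scaledIm k).differentiableAt hd,
    ContinuousLinearMap.fderiv, ContinuousLinearMap.comp_apply, fderiv_resolventKernel_apply hk hx,
    EuclideanSpace.inner_single_right]
  simp

/-! ### Integrability of the kernels -/

/-- `∫ exp (-k s) s ^ (-a) exp (-|x|² / (c s)) ds` over `s > 0`, a bound for the kernels. -/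
noncomputable def majorant {N : ℕ} (k a c : ℝ) (x : Space N) : ENNReal :=
  ∫⁻ s in Set.Ioi (0 : ℝ), ENNReal.ofReal (majorantIntegrand k a c (‖x‖ ^ 2) s)

lemma lintegral_rpow_mul_exp_lt_top {k b : ℝ} (hk : 0 < k) (hb : b < 1) :
    ∫⁻ s in Set.Ioi (0 : ℝ), ENNReal.ofReal (Real.exp (-k * s) * s ^ (-b)) < ⊤ := by
  have h := integrableOn_rpow_mul_exp_neg_mul_rpow (p := 1) (s := -b) (b := k) (by linarith)
    one_pos hk
  refine (Integrable.lintegral_lt_top (f := fun s => Real.exp (-k * s) * s ^ (-b)) ?_)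
  refine h.congr (Filter.Eventually.of_forall fun s => ?_)
  simp [mul_comm]

lemma lintegral_exp_neg_norm_sq {N : ℕ} {b : ℝ} (hb : 0 < b) :
    ∫⁻ x : Space N, ENNReal.ofReal (Real.exp (-b * ‖x‖ ^ 2)) =
      ENNReal.ofReal ((Real.pi / b) ^ ((N : ℝ) / 2)) := by
  have h := GaussianFourier.integral_rexp_neg_mul_sq_norm (V := Space N) hb
  rw [finrank_euclideanSpace_fin] at h
  -- A non-integrable function has Bochner integral 0, whereas the known value is positive.
  have hi : Integrable (fun x : Space N => Real.exp (-b * ‖x‖ ^ 2)) := by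
    by_contra hn
    rw [integral_undef hn] at h
    have : 0 < (Real.pi / b) ^ ((N : ℝ) / 2) := Real.rpow_pos_of_pos (by positivity) _
    exact this.ne h
  rw [← ofReal_integral_eq_lintegral_ofReal hi (Filter.Eventually.of_forall fun x => by positivity),
    h]

/-- Jensen's inequality for `t ↦ t ^ q`, with a weight. -/
lemma lintegral_mul_rpow_le {α : Type*} [MeasurableSpace α] {μ : Measure α} {w h : α → ENNReal}
    (hw : AEMeasurable w μ) (hh : AEMeasurable h μ) {q : ℝ} (hq : 1 ≤ q) :
    (∫⁻ x, w x * h x ∂μ) ^ q ≤ (∫⁻ x, w x * h x ^ q ∂μ) * (∫⁻ x, w x ∂μ) ^ (q - 1) := by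
  have hq0 : 0 < q := by linarith
  have h1 : ∫⁻ x, w x * h x ∂μ ≤
      (∫⁻ x, w x * h x ^ q ∂μ) ^ (1 / q) * (∫⁻ x, w x ∂μ) ^ (1 - 1 / q) := by
    have hq1 : 0 ≤ 1 - 1 / q := by
      rw [sub_nonneg, div_le_one hq0]; exact hq
    -- Hölder's inequality for the factorisation `w h = (w h^q)^{1/q} w^{1 - 1/q}`.
    calc ∫⁻ x, w x * h x ∂μ = ∫⁻ x, (w x * h x ^ q) ^ (1 / q) * w x ^ (1 - 1 / q) ∂μ := by
          refine lintegral_congr fun x => ?_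
          rw [ENNReal.mul_rpow_of_nonneg _ _ (by positivity), ← ENNReal.rpow_mul,
            mul_one_div_cancel hq0.ne', ENNReal.rpow_one, mul_right_comm,
            ← ENNReal.rpow_add_of_nonneg _ _ (by positivity) hq1]
          simp
      _ ≤ _ := ENNReal.lintegral_mul_norm_pow_le (hw.mul (hh.pow_const q)) hw
          (by positivity) hq1 (by ring)
  calc (∫⁻ x, w x * h x ∂μ) ^ q ≤
      ((∫⁻ x, w x * h x ^ q ∂μ) ^ (1 / q) * (∫⁻ x, w x ∂μ) ^ (1 - 1 / q)) ^ q := by gcongr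
    _ = _ := by
      rw [ENNReal.mul_rpow_of_nonneg _ _ hq0.le, ← ENNReal.rpow_mul, ← ENNReal.rpow_mul,
        one_div_mul_cancel hq0.ne', ENNReal.rpow_one]
      congr 2
      field_simp

lemma measurable_majorantIntegrand_uncurry {N : ℕ} (k a c : ℝ) :
    Measurable fun z : Space N × ℝ => majorantIntegrand k a c (‖z.1‖ ^ 2) z.2 := by
  unfold majorantIntegrand
  fun_prop

/-- Jensen's inequality for the weight `exp (-k s) s^{-b}`, then Tonelli. The choice `b = a -
N/(2q)` makes the `x`-integral of the `q`-th power of the remaining Gaussian factor independent of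
`s`, and the weight has finite mass because `b < 1`. -/
lemma lintegral_majorant_rpow_lt_top {N : ℕ} {k a c q : ℝ} (hk : 0 < k) (hc : 0 < c) (hq : 1 ≤ q)
    (ha : a - N / (2 * q) < 1) :
    ∫⁻ x : Space N, majorant k a c x ^ q < ⊤ := by
  have hq0 : 0 < q := by linarith
  set b := a - N / (2 * q) with hb
  set w : ℝ → ENNReal := fun s => ENNReal.ofReal (Real.exp (-k * s) * s ^ (-b)) with hw
  set h : Space N → ℝ → ENNReal := fun x s =>
    ENNReal.ofReal (s ^ (b - a) * Real.exp (-(‖x‖ ^ 2 / (c * s)))) with hh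
  have hwm : Measurable w := by rw [hw]; fun_prop
  have hhm : Measurable (Function.uncurry h) := by
    unfold Function.uncurry; rw [hh]; fun_prop
  have hhm' : ∀ x, Measurable (h x) := fun x => hhm.comp measurable_prodMk_left
  have hw_top := lintegral_rpow_mul_exp_lt_top hk ha
  have hmaj : ∀ x : Space N, majorant k a c x = ∫⁻ s in Set.Ioi (0 : ℝ), w s * h x s := by
    intro x
    refine setLIntegral_congr_fun measurableSet_Ioi fun s hs => ?_
    have hs' : 0 < s := hs
    simp only [hw, hh]
    rw [← ENNReal.ofReal_mul (by positivity)]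
    congr 1
    unfold majorantIntegrand
    have : s ^ (-a) = s ^ (-b) * s ^ (b - a) := by
      rw [← Real.rpow_add hs']; congr 1; ring
    rw [this]; ring
  have hx : ∀ s ∈ Set.Ioi (0 : ℝ), ∫⁻ x : Space N, w s * h x s ^ q =
      w s * ENNReal.ofReal ((Real.pi * c / q) ^ ((N : ℝ) / 2)) := by
    intro s hs
    have hs' : 0 < s := hs
    have hms : Measurable fun x => h x s ^ q := (hhm.comp measurable_prodMk_right).pow_const q
    rw [lintegral_const_mul _ hms]
    congr 1
    have h1 : ∀ x : Space N, h x s ^ q = ENNReal.ofReal (s ^ (-((N : ℝ) / 2))) *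
        ENNReal.ofReal (Real.exp (-(q / (c * s)) * ‖x‖ ^ 2)) := by
      intro x
      simp only [hh]
      rw [ENNReal.ofReal_rpow_of_nonneg (by positivity) hq0.le,
        Real.mul_rpow (by positivity) (by positivity), ← Real.rpow_mul hs'.le, ← Real.exp_mul,
        ENNReal.ofReal_mul (by positivity)]
      congr 3
      · rw [hb]; field_simp; ring
      · ring
    simp_rw [h1]
    rw [lintegral_const_mul _ (by fun_prop), lintegral_exp_neg_norm_sq (by positivity),
      ← ENNReal.ofReal_mul (by positivity)]
    congr 1
    have : Real.pi / (q / (c * s)) = Real.pi * c / q * s := by field_simp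
    rw [this, Real.mul_rpow (by positivity) hs'.le, Real.rpow_neg hs'.le]
    field_simp
  calc ∫⁻ x : Space N, majorant k a c x ^ q
      ≤ ∫⁻ x : Space N, (∫⁻ s in Set.Ioi (0 : ℝ), w s * h x s ^ q) *
          (∫⁻ s in Set.Ioi (0 : ℝ), w s) ^ (q - 1) := by
        refine lintegral_mono fun x => ?_
        rw [hmaj]
        exact lintegral_mul_rpow_le hwm.aemeasurable (hhm' x).aemeasurable hq
    _ = (∫⁻ s in Set.Ioi (0 : ℝ), w s * ENNReal.ofReal ((Real.pi * c / q) ^ ((N : ℝ) / 2))) *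
          (∫⁻ s in Set.Ioi (0 : ℝ), w s) ^ (q - 1) := by
        have hm : Measurable (Function.uncurry fun (x : Space N) s => w s * h x s ^ q) :=
          (hwm.comp measurable_snd).mul (hhm.pow_const q)
        have hm' : Measurable fun x : Space N => ∫⁻ s in Set.Ioi (0 : ℝ), w s * h x s ^ q :=
          hm.lintegral_prod_right'
        rw [lintegral_mul_const _ hm', lintegral_lintegral_swap hm.aemeasurable]
        congr 1
        exact setLIntegral_congr_fun measurableSet_Ioi hx
    _ < ⊤ := by
        rw [lintegral_mul_const _ hwm]
        exact ENNReal.mul_lt_top (ENNReal.mul_lt_top hw_top ENNReal.ofReal_lt_top)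
          (ENNReal.rpow_lt_top_of_nonneg (by linarith) hw_top.ne)

/-- A function of `(x, s)` bounded by a `majorantIntegrand` is integrable on `ℝ^N × (0, ∞)`. -/
lemma integrable_prod_of_le_majorantIntegrand {N : ℕ} {k a c C : ℝ} (hk : 0 < k) (hc : 0 < c)
    (ha : a - N / 2 < 1) {F : Space N × ℝ → ℂ} (hF : Measurable F)
    (hbound : ∀ x : Space N, ∀ s : ℝ, 0 < s →
      ‖F (x, s)‖ ≤ C * majorantIntegrand k a c (‖x‖ ^ 2) s) :
    Integrable F ((volume : Measure (Space N)).prod (volume.restrict (Set.Ioi (0 : ℝ)))) := by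
  refine ⟨hF.aestronglyMeasurable, ?_⟩
  rw [HasFiniteIntegral, lintegral_prod _ hF.enorm.aemeasurable]
  have hmm : ∀ x : Space N, Measurable fun s => majorantIntegrand k a c (‖x‖ ^ 2) s := fun x =>
    (measurable_majorantIntegrand_uncurry (N := N) k a c).comp (measurable_prodMk_left (x := x))
  calc ∫⁻ x : Space N, ∫⁻ s in Set.Ioi (0 : ℝ), ‖F (x, s)‖ₑ
      ≤ ∫⁻ x : Space N, ENNReal.ofReal C * majorant k a c x := by
        refine lintegral_mono fun x => ?_
        simp only [majorant]
        rw [← lintegral_const_mul _ (hmm x).ennreal_ofReal]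
        refine setLIntegral_mono' measurableSet_Ioi fun s hs => ?_
        rw [← ENNReal.ofReal_mul' (majorantIntegrand_nonneg k a c _ hs), ← ofReal_norm]
        exact ENNReal.ofReal_le_ofReal (hbound x s hs)
    _ < ⊤ := by
        have h := lintegral_majorant_rpow_lt_top (N := N) (q := 1) hk hc le_rfl (by simpa using ha)
        simp only [ENNReal.rpow_one] at h
        rw [lintegral_const_mul' _ _ ENNReal.ofReal_ne_top]
        exact ENNReal.mul_lt_top ENNReal.ofReal_lt_top h

lemma measurable_resolventIntegrand_norm_sq (N : ℕ) (k : ℝ) (m : ℕ) :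
    Measurable fun z : Space N × ℝ => resolventIntegrand N k m (‖z.1‖ ^ 2) z.2 := by
  unfold resolventIntegrand
  fun_prop

lemma integrable_resolventIntegrand_prod {N : ℕ} {k : ℝ} (hk : 0 < k) :
    Integrable (fun z : Space N × ℝ => resolventIntegrand N k 0 (‖z.1‖ ^ 2) z.2)
      ((volume : Measure (Space N)).prod (volume.restrict (Set.Ioi (0 : ℝ)))) := by
  refine integrable_prod_of_le_majorantIntegrand (a := (N : ℝ) / 2 + (0 : ℕ)) (c := 8)
    (C := resolventConst N 0) hk (by norm_num) (by simp)
    (measurable_resolventIntegrand_norm_sq N k 0) fun x s hs => ?_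
  exact (norm_resolventIntegrand N k 0 _ hs).le

/-- The exponent `N/2 + 1` of the derivative is just too singular. Half of the Gaussian turns the
factor `|x|` into a multiple of `√s`: the exponent drops to `N/2 + 1/2` while 8 becomes 16. -/
lemma integrable_coord_smul_resolventIntegrand_prod {N : ℕ} {k : ℝ} (hk : 0 < k) (i : Fin N) :
    Integrable (fun z : Space N × ℝ =>
        (2 * z.1 i) • resolventIntegrand N k 1 (‖z.1‖ ^ 2) z.2)
      ((volume : Measure (Space N)).prod (volume.restrict (Set.Ioi (0 : ℝ)))) := by
  refine integrable_prod_of_le_majorantIntegrand (a := (N : ℝ) / 2 + 1 / 2) (c := 16)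
    (C := 8 * resolventConst N 1) hk (by norm_num) (by norm_num) ?_ fun x s hs => ?_
  · exact (by fun_prop : Measurable fun z : Space N × ℝ => 2 * z.1 i).smul
      (measurable_resolventIntegrand_norm_sq N k 1)
  · have h1 : ‖2 * x i‖ ≤ 2 * ‖x‖ := by
      rw [norm_mul]; norm_num; exact PiLp.norm_apply_le x i
    have h2 : ‖x‖ * majorantIntegrand k ((N : ℝ) / 2 + (1 : ℕ)) 8 (‖x‖ ^ 2) s ≤
        4 * majorantIntegrand k ((N : ℝ) / 2 + 1 / 2) 16 (‖x‖ ^ 2) s := by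
      -- Normalised so that `z²` is exactly half of `|x|² / (8 s)`; then `z exp (-z²) ≤ 1` absorbs
      -- `|x|`.
      set z := ‖x‖ / (4 * √s) with hz
      have hss : 0 < √s := Real.sqrt_pos.2 hs
      have hz2 : z ^ 2 = ‖x‖ ^ 2 / (16 * s) := by
        rw [hz, div_pow, mul_pow, Real.sq_sqrt hs.le]; norm_num
      have hxz : ‖x‖ = 4 * (√s * z) := by rw [hz]; field_simp
      have hzexp : z * Real.exp (-z ^ 2) ≤ 1 := by
        rw [Real.exp_neg, ← div_eq_mul_inv, div_le_one (Real.exp_pos _)]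
        nlinarith [Real.add_one_le_exp (z ^ 2), sq_nonneg (z - 1)]
      have hpow : s ^ (-((N : ℝ) / 2 + (1 : ℕ))) * √s = s ^ (-((N : ℝ) / 2 + 1 / 2)) := by
        rw [Real.sqrt_eq_rpow, ← Real.rpow_add hs]
        congr 1; push_cast; ring
      have h8 : ‖x‖ ^ 2 / (8 * s) = z ^ 2 + ‖x‖ ^ 2 / (16 * s) := by
        rw [hz2]; field_simp; ring
      unfold majorantIntegrand
      rw [h8, neg_add (z ^ 2), Real.exp_add]
      calc ‖x‖ * (Real.exp (-k * s) * s ^ (-((N : ℝ) / 2 + (1 : ℕ))) *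
            (Real.exp (-z ^ 2) * Real.exp (-(‖x‖ ^ 2 / (16 * s)))))
          = 4 * (Real.exp (-k * s) * (s ^ (-((N : ℝ) / 2 + (1 : ℕ))) * √s) *
            Real.exp (-(‖x‖ ^ 2 / (16 * s)))) * (z * Real.exp (-z ^ 2)) := by
            nth_rw 1 [hxz]; ring
        _ ≤ 4 * (Real.exp (-k * s) * (s ^ (-((N : ℝ) / 2 + (1 : ℕ))) * √s) *
            Real.exp (-(‖x‖ ^ 2 / (16 * s)))) * 1 := by gcongr
        _ = _ := by rw [hpow, mul_one]
    rw [norm_smul, norm_resolventIntegrand _ _ _ _ hs]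
    calc ‖2 * x i‖ * (resolventConst N 1 *
          majorantIntegrand k ((N : ℝ) / 2 + (1 : ℕ)) 8 (‖x‖ ^ 2) s)
        ≤ 2 * ‖x‖ * (resolventConst N 1 *
          majorantIntegrand k ((N : ℝ) / 2 + (1 : ℕ)) 8 (‖x‖ ^ 2) s) := by
          refine mul_le_mul_of_nonneg_right h1 (mul_nonneg (resolventConst_nonneg N 1)
            (majorantIntegrand_nonneg _ _ _ _ hs))
      _ = 2 * resolventConst N 1 *
          (‖x‖ * majorantIntegrand k ((N : ℝ) / 2 + (1 : ℕ)) 8 (‖x‖ ^ 2) s) := by ring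
      _ ≤ 2 * resolventConst N 1 *
          (4 * majorantIntegrand k ((N : ℝ) / 2 + 1 / 2) 16 (‖x‖ ^ 2) s) :=
          mul_le_mul_of_nonneg_left h2 (mul_nonneg (by norm_num) (resolventConst_nonneg N 1))
      _ = _ := by ring

lemma integrable_resolventKernel {N : ℕ} {k : ℝ} (hk : 0 < k) :
    Integrable (resolventKernel (N := N) k) :=
  (integrable_resolventIntegrand_prod hk).integral_prod_left

lemma memLp_resolventKernel {N : ℕ} {k q : ℝ} (hk : 0 < k) (hq : 1 ≤ q)
    (hqN : (N : ℝ) / 2 - N / (2 * q) < 1) :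
    MemLp (resolventKernel (N := N) k) (ENNReal.ofReal q) := by
  have hq0 : 0 < q := by linarith
  refine ⟨(integrable_resolventKernel hk).1, ?_⟩
  rw [eLpNorm_lt_top_iff_lintegral_rpow_enorm_lt_top (by simpa using hq0) ENNReal.ofReal_ne_top,
    ENNReal.toReal_ofReal hq0.le]
  have hle : ∀ x : Space N, ‖resolventKernel k x‖ₑ ≤
      ENNReal.ofReal (resolventConst N 0) * majorant k ((N : ℝ) / 2 + (0 : ℕ)) 8 x := by
    intro x
    refine (enorm_integral_le_lintegral_enorm _).trans ?_
    rw [majorant, ← lintegral_const_mul' _ _ ENNReal.ofReal_ne_top]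
    refine setLIntegral_mono' measurableSet_Ioi fun s hs => ?_
    rw [← ENNReal.ofReal_mul (resolventConst_nonneg N 0), ← ofReal_norm,
      norm_resolventIntegrand _ _ _ _ hs]
  calc ∫⁻ x : Space N, ‖resolventKernel k x‖ₑ ^ q
      ≤ ∫⁻ x : Space N, ENNReal.ofReal (resolventConst N 0) ^ q *
          majorant k ((N : ℝ) / 2 + (0 : ℕ)) 8 x ^ q := by
        refine lintegral_mono fun x => ?_
        rw [← ENNReal.mul_rpow_of_nonneg _ _ hq0.le]
        exact ENNReal.rpow_le_rpow (hle x) hq0.le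
    _ < ⊤ := by
        have hfin := ENNReal.rpow_lt_top_of_nonneg hq0.le
          (ENNReal.ofReal_ne_top (r := resolventConst N 0))
        rw [lintegral_const_mul' _ _ hfin.ne]
        exact ENNReal.mul_lt_top hfin
          (lintegral_majorant_rpow_lt_top hk (by norm_num) hq (by simpa using hqN))

/-! ### Young's inequality and pairings with convolutions -/

/-- The convolution of the absolute values. -/
noncomputable def absConv {N : ℕ} (f g : Space N → ℝ) (x : Space N) : ENNReal :=
  ∫⁻ z, ‖f z‖ₑ * ‖g (x - z)‖ₑ

section Convolution

variable {N : ℕ} {f g : Space N → ℝ}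

lemma aestronglyMeasurable_comp_sub (hg : AEStronglyMeasurable g volume) (x : Space N) :
    AEStronglyMeasurable (fun z => g (x - z)) volume :=
  hg.comp_quasiMeasurePreserving (quasiMeasurePreserving_sub_left volume x)

lemma aestronglyMeasurable_conv_integrand (hf : AEStronglyMeasurable f volume)
    (hg : AEStronglyMeasurable g volume) :
    AEStronglyMeasurable (fun w : Space N × Space N => f w.2 * g (w.1 - w.2))
      (volume.prod volume) :=
  hf.convolution_integrand (ContinuousLinearMap.mul ℝ ℝ) hg

lemma aemeasurable_absConv (hf : AEStronglyMeasurable f volume)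
    (hg : AEStronglyMeasurable g volume) : AEMeasurable (absConv f g) volume := by
  have h := (aestronglyMeasurable_conv_integrand hf hg).enorm
  simp only [enorm_mul] at h
  exact h.lintegral_prod_right'

/-- **Young's convolution inequality**, in the form of finiteness. -/
lemma lintegral_absConv_rpow_lt_top {p q r : ℝ} (hp : 1 ≤ p) (hq : 1 ≤ q) (hr : 1 ≤ r)
    (hpqr : 1 / p + 1 / q = 1 + 1 / r) (hf : MemLp f (ENNReal.ofReal p))
    (hg : MemLp g (ENNReal.ofReal q)) : ∫⁻ x, absConv f g x ^ r < ⊤ := by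
  have hp0 : 0 < p := by linarith
  have hq0 : 0 < q := by linarith
  have hr0 : 0 < r := by linarith
  have hp1 : 1 / p ≤ 1 := by rw [div_le_one hp0]; exact hp
  have hq1 : 1 / q ≤ 1 := by rw [div_le_one hq0]; exact hq
  have e1 : 0 ≤ 1 / r := by positivity
  have e2 : 0 ≤ 1 / p - 1 / r := by linarith
  have e3 : 0 ≤ 1 / q - 1 / r := by linarith
  have hA : ∫⁻ z, ‖f z‖ₑ ^ p < ⊤ := by
    have := (eLpNorm_lt_top_iff_lintegral_rpow_enorm_lt_top (by simpa using hp0)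
      ENNReal.ofReal_ne_top).1 hf.2
    rwa [ENNReal.toReal_ofReal hp0.le] at this
  have hB : ∫⁻ z, ‖g z‖ₑ ^ q < ⊤ := by
    have := (eLpNorm_lt_top_iff_lintegral_rpow_enorm_lt_top (by simpa using hq0)
      ENNReal.ofReal_ne_top).1 hg.2
    rwa [ENNReal.toReal_ofReal hq0.le] at this
  set A := ∫⁻ z, ‖f z‖ₑ ^ p
  set B := ∫⁻ z, ‖g z‖ₑ ^ q
  have hfm : AEMeasurable (fun z => ‖f z‖ₑ ^ p) volume := hf.1.enorm.pow_const p
  have hgm : ∀ x, AEMeasurable (fun z => ‖g (x - z)‖ₑ ^ q) volume := fun x =>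
    (aestronglyMeasurable_comp_sub hg.1 x).enorm.pow_const q
  -- Three-factor Hölder with `|f||g| = (|f|^p |g|^q)^{1/r} (|f|^p)^{1/p - 1/r} (|g|^q)^{1/q -
  -- 1/r}`; the exponents add up to 1 by `hpqr`.
  have hpoint : ∀ x, absConv f g x ≤ (∫⁻ z, ‖f z‖ₑ ^ p * ‖g (x - z)‖ₑ ^ q) ^ (1 / r) *
      A ^ (1 / p - 1 / r) * B ^ (1 / q - 1 / r) := by
    intro x
    have h := ENNReal.lintegral_prod_norm_pow_le (μ := (volume : Measure (Space N))) Finset.univ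
      (f := ![fun z => ‖f z‖ₑ ^ p * ‖g (x - z)‖ₑ ^ q, fun z => ‖f z‖ₑ ^ p,
        fun z => ‖g (x - z)‖ₑ ^ q]) (p := ![1 / r, 1 / p - 1 / r, 1 / q - 1 / r])
      (by
        intro i _
        fin_cases i
        · exact hfm.mul (hgm x)
        · exact hfm
        · exact hgm x)
      (by simp only [Fin.sum_univ_three, Matrix.cons_val]; linarith)
      (by
        intro i _
        fin_cases i
        · exact e1
        · exact e2
        · exact e3)
    simp only [Fin.prod_univ_three, Matrix.cons_val] at h
    rw [lintegral_sub_left_eq_self (fun z => ‖g z‖ₑ ^ q) x] at h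
    refine le_trans (le_of_eq ?_) h
    refine lintegral_congr fun z => ?_
    have hF : ∀ (a : ENNReal) {t : ℝ}, 0 < t → 0 ≤ 1 / t - 1 / r →
        (a ^ t) ^ (1 / r) * (a ^ t) ^ (1 / t - 1 / r) = a := by
      intro a t ht h'
      rw [← ENNReal.rpow_add_of_nonneg _ _ e1 h', ← ENNReal.rpow_mul]
      have : t * (1 / r + (1 / t - 1 / r)) = 1 := by field_simp; ring
      rw [this, ENNReal.rpow_one]
    rw [ENNReal.mul_rpow_of_nonneg _ _ e1]
    nth_rw 1 [← hF ‖f z‖ₑ hp0 e2, ← hF ‖g (x - z)‖ₑ hq0 e3]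
    ring
  have hjoint : AEMeasurable (Function.uncurry fun x z : Space N =>
      ‖f z‖ₑ ^ p * ‖g (x - z)‖ₑ ^ q) (volume.prod volume) := by
    have h1 : AEStronglyMeasurable (fun w : Space N × Space N => f w.2) (volume.prod volume) :=
      hf.1.comp_snd
    have h2 : AEStronglyMeasurable (fun w : Space N × Space N => g (w.1 - w.2))
        (volume.prod volume) :=
      hg.1.comp_quasiMeasurePreserving (quasiMeasurePreserving_sub_of_right_invariant volume volume)
    exact (h1.enorm.pow_const p).mul (h2.enorm.pow_const q)
  have hint : ∫⁻ x, ∫⁻ z, ‖f z‖ₑ ^ p * ‖g (x - z)‖ₑ ^ q = A * B := by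
    rw [lintegral_lintegral_swap hjoint, ← lintegral_mul_const'' _ hfm]
    refine lintegral_congr fun z => ?_
    have hm : AEMeasurable (fun x => ‖g (x - z)‖ₑ ^ q) volume :=
      ((hg.1.comp_measurePreserving (measurePreserving_sub_right volume z)).enorm.pow_const q)
    rw [lintegral_const_mul'' _ hm, lintegral_sub_right_eq_self (fun z => ‖g z‖ₑ ^ q) z]
  calc ∫⁻ x, absConv f g x ^ r
      ≤ ∫⁻ x, (∫⁻ z, ‖f z‖ₑ ^ p * ‖g (x - z)‖ₑ ^ q) *
          ((A ^ (1 / p - 1 / r)) ^ r * (B ^ (1 / q - 1 / r)) ^ r) := by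
        refine lintegral_mono fun x => ?_
        refine (ENNReal.rpow_le_rpow (hpoint x) hr0.le).trans (le_of_eq ?_)
        rw [ENNReal.mul_rpow_of_nonneg _ _ hr0.le, ENNReal.mul_rpow_of_nonneg _ _ hr0.le,
          ← ENNReal.rpow_mul, one_div_mul_cancel hr0.ne', ENNReal.rpow_one, mul_assoc]
    _ = A * B * ((A ^ (1 / p - 1 / r)) ^ r * (B ^ (1 / q - 1 / r)) ^ r) := by
        have hm : AEMeasurable fun x => ∫⁻ z, ‖f z‖ₑ ^ p * ‖g (x - z)‖ₑ ^ q :=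
          hjoint.lintegral_prod_right'
        rw [lintegral_mul_const'' _ hm, hint]
    _ < ⊤ := by
        refine ENNReal.mul_lt_top (ENNReal.mul_lt_top hA hB) (ENNReal.mul_lt_top ?_ ?_)
        · exact ENNReal.rpow_lt_top_of_nonneg hr0.le (ENNReal.rpow_lt_top_of_nonneg e2 hA.ne).ne
        · exact ENNReal.rpow_lt_top_of_nonneg hr0.le (ENNReal.rpow_lt_top_of_nonneg e3 hB.ne).ne

variable {r : ℝ}

lemma convExistsAE_of_absConv (hr : 1 ≤ r) (hf : AEStronglyMeasurable f volume)
    (hg : AEStronglyMeasurable g volume) (h : ∫⁻ x, absConv f g x ^ r < ⊤) :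
    ConvExistsAE f g := by
  have hae := ae_lt_top' ((aemeasurable_absConv hf hg).pow_const r) h.ne
  filter_upwards [hae] with x hx
  refine ⟨hf.mul (aestronglyMeasurable_comp_sub hg x), ?_⟩
  have hx' : absConv f g x < ⊤ := by
    by_contra hn
    rw [not_lt_top_iff.1 hn, ENNReal.top_rpow_of_pos (by linarith)] at hx
    exact lt_irrefl _ hx
  simpa [HasFiniteIntegral, absConv] using hx'

lemma memLp_conv (hr : 1 ≤ r) (hf : AEStronglyMeasurable f volume)
    (hg : AEStronglyMeasurable g volume) (h : ∫⁻ x, absConv f g x ^ r < ⊤) :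
    MemLp (conv f g) (ENNReal.ofReal r) := by
  have hr0 : 0 < r := by linarith
  refine ⟨(aestronglyMeasurable_conv_integrand hf hg).integral_prod_right', ?_⟩
  rw [eLpNorm_lt_top_iff_lintegral_rpow_enorm_lt_top (by simpa using hr0) ENNReal.ofReal_ne_top,
    ENNReal.toReal_ofReal hr0.le]
  refine lt_of_le_of_lt (lintegral_mono fun x => ENNReal.rpow_le_rpow ?_ hr0.le) h
  refine (enorm_integral_le_lintegral_enorm _).trans (le_of_eq ?_)
  simp [absConv]

lemma integrable_conv_integrand_mul {φ : Space N → ℝ} {M : ℝ} (hr : 1 ≤ r)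
    (hf : AEStronglyMeasurable f volume)
    (hg : AEStronglyMeasurable g volume) (h : ∫⁻ x, absConv f g x ^ r < ⊤)
    (hφ : Integrable φ) (hM : ∀ x, ‖φ x‖ ≤ M) :
    Integrable (fun w : Space N × Space N => f w.2 * g (w.1 - w.2) * φ w.1)
      (volume.prod volume) := by
  have hm : AEStronglyMeasurable (fun w : Space N × Space N => f w.2 * g (w.1 - w.2) * φ w.1)
      (volume.prod volume) :=
    (aestronglyMeasurable_conv_integrand hf hg).mul hφ.1.comp_fst
  refine ⟨hm, ?_⟩
  rw [HasFiniteIntegral, lintegral_prod _ hm.enorm]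
  calc ∫⁻ x, ∫⁻ z, ‖f z * g (x - z) * φ x‖ₑ = ∫⁻ x, absConv f g x * ‖φ x‖ₑ := by
        refine lintegral_congr fun x => ?_
        simp only [enorm_mul]
        rw [lintegral_mul_const' _ _ enorm_ne_top, absConv]
    -- With `t` the value of `absConv`: `t |φ| ≤ |φ|` when `t ≤ 1`, and `t |φ| ≤ M t^r` when `t ≥
    -- 1`. No dual exponent is needed.
    _ ≤ ∫⁻ x, ‖φ x‖ₑ + ENNReal.ofReal M * absConv f g x ^ r := by
        refine lintegral_mono fun x => ?_
        have hφM : ‖φ x‖ₑ ≤ ENNReal.ofReal M := by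
          rw [← ofReal_norm]; exact ENNReal.ofReal_le_ofReal (hM x)
        rcases le_total (absConv f g x) 1 with h1 | h1
        · exact (mul_le_of_le_one_left' h1).trans le_self_add
        · refine le_trans ?_ le_add_self
          rw [mul_comm]
          gcongr
          simpa using ENNReal.rpow_le_rpow_of_exponent_le h1 hr
    _ < ⊤ := by
        rw [lintegral_add_left' hφ.1.enorm, lintegral_const_mul' _ _ ENNReal.ofReal_ne_top]
        exact ENNReal.add_lt_top.2 ⟨hφ.2, ENNReal.mul_lt_top ENNReal.ofReal_lt_top h⟩

lemma conv_pairing_inner {φ : Space N → ℝ} (z : Space N) :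
    ∫ x, f z * g (x - z) * φ x = f z * ∫ y, g y * φ (y + z) := by
  rw [← integral_add_right_eq_self (fun x => f z * g (x - z) * φ x) z, ← integral_const_mul]
  simp [mul_assoc]

/-- Pairing a convolution with a function moves the pairing to the kernel. -/
lemma integral_conv_mul {φ : Space N → ℝ} {M : ℝ} (hr : 1 ≤ r)
    (hf : AEStronglyMeasurable f volume)
    (hg : AEStronglyMeasurable g volume) (h : ∫⁻ x, absConv f g x ^ r < ⊤)
    (hφ : Integrable φ) (hM : ∀ x, ‖φ x‖ ≤ M) :
    ∫ x, conv f g x * φ x = ∫ z, f z * ∫ y, g y * φ (y + z) := by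
  have hi := integrable_conv_integrand_mul hr hf hg h hφ hM
  calc ∫ x, conv f g x * φ x = ∫ x, ∫ z, f z * g (x - z) * φ x := by
        refine integral_congr_ae (Filter.Eventually.of_forall fun x => ?_)
        simp only [conv, convolution, ContinuousLinearMap.mul_apply']
        rw [integral_mul_const]
    _ = ∫ z, ∫ x, f z * g (x - z) * φ x := integral_integral_swap hi
    _ = _ := by simp_rw [conv_pairing_inner]

lemma integrable_conv_pairing {φ : Space N → ℝ} {M : ℝ} (hr : 1 ≤ r)
    (hf : AEStronglyMeasurable f volume)
    (hg : AEStronglyMeasurable g volume) (h : ∫⁻ x, absConv f g x ^ r < ⊤)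
    (hφ : Integrable φ) (hM : ∀ x, ‖φ x‖ ≤ M) :
    Integrable fun z => f z * ∫ y, g y * φ (y + z) := by
  have hi := (integrable_conv_integrand_mul hr hf hg h hφ hM).integral_prod_right
  simpa only [conv_pairing_inner] using hi

lemma integrable_conv_mul {φ : Space N → ℝ} {M : ℝ} (hr : 1 ≤ r)
    (hf : AEStronglyMeasurable f volume)
    (hg : AEStronglyMeasurable g volume) (h : ∫⁻ x, absConv f g x ^ r < ⊤)
    (hφ : Integrable φ) (hM : ∀ x, ‖φ x‖ ≤ M) :
    Integrable fun x => conv f g x * φ x := by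
  have hi := (integrable_conv_integrand_mul hr hf hg h hφ hM).integral_prod_left
  simpa only [integral_mul_const, conv, convolution, ContinuousLinearMap.mul_apply'] using hi

end Convolution

/-! ### The resolvent equation in the sense of distributions -/

section Distributional

open FourierTransform SchwartzMap

lemma integral_fourier_mul_eq_flip {N : ℕ} {f g : Space N → ℂ} (hf : Integrable f)
    (hg : Integrable g) : ∫ x, 𝓕 f x * g x = ∫ x, f x * 𝓕 g x := by
  have h := VectorFourier.integral_fourierIntegral_smul_eq_flip (L := innerₗ (Space N))
    Real.continuous_fourierChar continuous_inner hf hg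
  rw [flip_innerₗ] at h
  exact h

/-- The symbol `4π²|ξ|² - i k` of `-Δ - i k`. -/
noncomputable def resolventSymbol {N : ℕ} (k : ℝ) (ξ : Space N) : ℂ :=
  4 * (Real.pi : ℂ) ^ 2 * (‖ξ‖ : ℂ) ^ 2 - Complex.I * k

/-- Strict negativity for `k > 0` gives both convergence of the ray integral on the Fourier side and
non-vanishing of the symbol. -/
lemma ray_mul_resolventSymbol_re {N : ℕ} (k : ℝ) (ξ : Space N) :
    (-((1 + Complex.I) * resolventSymbol k ξ)).re = -(4 * Real.pi ^ 2 * ‖ξ‖ ^ 2 + k) := by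
  have h : resolventSymbol k ξ = ((4 * Real.pi ^ 2 * ‖ξ‖ ^ 2 : ℝ) : ℂ) - Complex.I * k := by
    rw [resolventSymbol]; push_cast; rfl
  rw [h]
  simp only [Complex.neg_re, Complex.mul_re, Complex.add_re, Complex.add_im, Complex.sub_re,
    Complex.sub_im, Complex.one_re, Complex.one_im, Complex.I_re, Complex.I_im, Complex.ofReal_re,
    Complex.ofReal_im, Complex.mul_im]
  ring

lemma resolventSymbol_ne_zero {N : ℕ} {k : ℝ} (hk : 0 < k) (ξ : Space N) :
    resolventSymbol k ξ ≠ 0 := by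
  intro h
  have h1 := ray_mul_resolventSymbol_re k ξ
  rw [h] at h1
  simp only [mul_zero, neg_zero, Complex.zero_re] at h1
  have : 0 < 4 * Real.pi ^ 2 * ‖ξ‖ ^ 2 + k := by positivity
  linarith

/-- The heat kernel is the Fourier transform of a Gaussian. -/
lemma heatKernel_eq_fourier {N : ℕ} {t : ℂ} (ht : 0 < t.re) :
    heatKernel (N := N) t = 𝓕 fun v : Space N =>
      Complex.exp (-(4 * (Real.pi : ℂ) ^ 2 * t) * (‖v‖ : ℂ) ^ 2) := by
  have hpi : (Real.pi : ℂ) ≠ 0 := by exact_mod_cast Real.pi_ne_zero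
  have ht0 : t ≠ 0 := by rintro rfl; simp at ht
  have hre : 0 < (4 * (Real.pi : ℂ) ^ 2 * t).re := by
    have : (4 * (Real.pi : ℂ) ^ 2 * t) = ((4 * Real.pi ^ 2 : ℝ) : ℂ) * t := by push_cast; rfl
    rw [this, Complex.re_ofReal_mul]
    positivity
  have hre' : 0 < (4 * (Real.pi : ℂ) * t).re := by
    have : (4 * (Real.pi : ℂ) * t) = ((4 * Real.pi : ℝ) : ℂ) * t := by push_cast; rfl
    rw [this, Complex.re_ofReal_mul]
    positivity
  funext x
  rw [fourier_gaussian_innerProductSpace hre, finrank_euclideanSpace_fin, heatKernel]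
  have h1 : (Real.pi : ℂ) / (4 * (Real.pi : ℂ) ^ 2 * t) = (4 * (Real.pi : ℂ) * t)⁻¹ := by
    field_simp
  -- Inverting inside the principal power requires staying off the branch cut, guaranteed by `Re t >
  -- 0`.
  have harg : (4 * (Real.pi : ℂ) * t).arg ≠ Real.pi := by
    intro h
    rw [Complex.arg_eq_pi_iff] at h
    linarith [h.1]
  rw [h1, Complex.inv_cpow _ _ harg, Complex.cpow_neg]
  congr 2
  push_cast
  field_simp

lemma integrable_gaussian {N : ℕ} {t : ℂ} (ht : 0 < t.re) :
    Integrable fun v : Space N => Complex.exp (-(4 * (Real.pi : ℂ) ^ 2 * t) * (‖v‖ : ℂ) ^ 2) := by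
  have hre : 0 < (4 * (Real.pi : ℂ) ^ 2 * t).re := by
    have : (4 * (Real.pi : ℂ) ^ 2 * t) = ((4 * Real.pi ^ 2 : ℝ) : ℂ) * t := by push_cast; rfl
    rw [this, Complex.re_ofReal_mul]
    positivity
  simpa using GaussianFourier.integrable_cexp_neg_mul_sq_norm_add hre 0 (0 : Space N)

lemma fourier_laplacian_apply {N : ℕ} (φ : 𝓢(Space N, ℂ)) (ξ : Space N) :
    𝓕 (Δ φ) ξ = -(4 * (Real.pi : ℂ) ^ 2 * (‖ξ‖ : ℂ) ^ 2) * 𝓕 φ ξ := by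
  have hg : (fun x : Space N => ‖x‖ ^ 2).HasTemperateGrowth := by fun_prop
  rw [laplacian_eq_fourierMultiplierCLM, fourierMultiplierCLM_apply, FourierTransform.fourier_smul,
    fourier_fourierInv_eq, smul_apply, smulLeftCLM_apply_apply hg]
  simp only [neg_smul, Complex.real_smul]
  push_cast
  ring

/-- The function `-Δφ - i k φ`. -/
noncomputable def resolventOp {N : ℕ} (k : ℝ) (φ : 𝓢(Space N, ℂ)) : 𝓢(Space N, ℂ) :=
  -Δ φ - (Complex.I * k) • φ

lemma fourier_resolventOp_apply {N : ℕ} (k : ℝ) (φ : 𝓢(Space N, ℂ)) (ξ : Space N) :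
    𝓕 (resolventOp k φ) ξ = resolventSymbol k ξ * 𝓕 φ ξ := by
  have h : 𝓕 (resolventOp k φ) = -𝓕 (Δ φ) - (Complex.I * k) • 𝓕 φ := by
    simp only [resolventOp, sub_eq_add_neg, FourierTransform.fourier_add,
      FourierTransform.fourier_neg, FourierTransform.fourier_smul]
  rw [h, sub_apply, neg_apply, smul_apply,
    fourier_laplacian_apply, resolventSymbol, smul_eq_mul]
  ring

lemma resolventIntegrand_eq_heatKernel {N : ℕ} (k : ℝ) (x : Space N) (s : ℝ) :
    resolventIntegrand N k 0 (‖x‖ ^ 2) s = (1 + Complex.I) *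
      Complex.exp (Complex.I * k * ((1 + Complex.I) * s)) * heatKernel ((1 + Complex.I) * s) x := by
  simp [resolventIntegrand, heatKernel]

/-- The Fourier transform is moved from the Gaussian to the test function. The factor `exp (i k t)`
then merges with `exp (-4π²|ξ|² t)` into `exp (-t σ(ξ))`, with `σ` the symbol. -/
lemma integral_resolventIntegrand_mul {N : ℕ} {k s : ℝ} (hs : 0 < s) (φ : 𝓢(Space N, ℂ)) :
    ∫ x : Space N, resolventIntegrand N k 0 (‖x‖ ^ 2) s * resolventOp k φ x =
      ∫ ξ : Space N, (1 + Complex.I) *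
        Complex.exp (-((1 + Complex.I) * resolventSymbol k ξ) * s) * 𝓕 (resolventOp k φ) ξ := by
  have ht : 0 < ((1 + Complex.I) * s).re := by simpa using hs
  have h := integral_fourier_mul_eq_flip (integrable_gaussian (N := N) ht)
    (resolventOp k φ).integrable
  rw [← heatKernel_eq_fourier ht] at h
  simp only [resolventIntegrand_eq_heatKernel, mul_assoc ((1 + Complex.I) * _)]
  rw [integral_const_mul, h, ← integral_const_mul]
  refine integral_congr_ae (Filter.Eventually.of_forall fun ξ => ?_)
  simp only [fourier_coe]
  rw [← mul_assoc, mul_assoc (1 + Complex.I), ← Complex.exp_add]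
  congr 3
  rw [resolventSymbol]
  ring

/-- `(-Δ - i k) K = δ₀` in the sense of distributions, where `K` is the resolvent kernel. -/
theorem integral_resolventKernel_mul {N : ℕ} {k : ℝ} (hk : 0 < k) (φ : 𝓢(Space N, ℂ)) :
    ∫ x, resolventKernel k x * resolventOp k φ x = φ 0 := by
  set θ := resolventOp k φ with hθ
  have hi1 : Integrable (fun z : Space N × ℝ => resolventIntegrand N k 0 (‖z.1‖ ^ 2) z.2 * θ z.1)
      ((volume : Measure (Space N)).prod (volume.restrict (Set.Ioi (0 : ℝ)))) := by
    refine (integrable_resolventIntegrand_prod hk).mul_bdd (c := SchwartzMap.seminorm ℝ 0 0 θ)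
      (θ.continuous.comp continuous_fst).aestronglyMeasurable
      (Filter.Eventually.of_forall fun z => norm_le_seminorm ℝ θ z.1)
  have hi2 : Integrable (fun z : Space N × ℝ => (1 + Complex.I) *
        Complex.exp (-((1 + Complex.I) * resolventSymbol k z.1) * z.2) * 𝓕 θ z.1)
      ((volume : Measure (Space N)).prod (volume.restrict (Set.Ioi (0 : ℝ)))) := by
    have hb : Integrable (fun z : Space N × ℝ => 𝓕 θ z.1 * ((√2 * Real.exp (-k * z.2) : ℝ) : ℂ))
      ((volume : Measure (Space N)).prod (volume.restrict (Set.Ioi (0 : ℝ)))) :=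
      (𝓕 θ).integrable.mul_prod ((exp_neg_integrableOn_Ioi 0 hk).const_mul √2).ofReal
    refine hb.norm.mono' ?_ ?_
    · have hc := (𝓕 θ).continuous
      have : Continuous fun z : Space N × ℝ => (1 + Complex.I) *
        Complex.exp (-((1 + Complex.I) * resolventSymbol k z.1) * z.2) * 𝓕 θ z.1 := by
        unfold resolventSymbol
        fun_prop
      exact this.aestronglyMeasurable
    · have hpos : ∀ᵐ z ∂((volume : Measure (Space N)).prod (volume.restrict (Set.Ioi (0 : ℝ)))),
          0 < z.2 := by
        have : ∀ᵐ s ∂(volume.restrict (Set.Ioi (0 : ℝ))), 0 < s := by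
          filter_upwards [ae_restrict_mem measurableSet_Ioi] with s hs using hs
        exact Measure.quasiMeasurePreserving_snd.ae this
      filter_upwards [hpos] with z hz
      rw [norm_mul, norm_mul, norm_mul, norm_one_add_I, Complex.norm_exp, Complex.re_mul_ofReal,
        ray_mul_resolventSymbol_re, Complex.norm_real, Real.norm_of_nonneg (by positivity),
        mul_comm]
      gcongr
      have : 0 ≤ 4 * Real.pi ^ 2 * ‖z.1‖ ^ 2 := by positivity
      linarith
  calc ∫ x, resolventKernel k x * θ x
      = ∫ x, ∫ s in Set.Ioi (0 : ℝ), resolventIntegrand N k 0 (‖x‖ ^ 2) s * θ x := by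
        simp_rw [integral_mul_const]; rfl
    _ = ∫ s in Set.Ioi (0 : ℝ), ∫ x : Space N, resolventIntegrand N k 0 (‖x‖ ^ 2) s * θ x :=
        integral_integral_swap hi1
    _ = ∫ s in Set.Ioi (0 : ℝ), ∫ ξ : Space N, (1 + Complex.I) *
        Complex.exp (-((1 + Complex.I) * resolventSymbol k ξ) * s) * 𝓕 θ ξ :=
        setIntegral_congr_fun measurableSet_Ioi fun s hs => integral_resolventIntegrand_mul hs φ
    _ = ∫ ξ : Space N, ∫ s in Set.Ioi (0 : ℝ), (1 + Complex.I) *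
        Complex.exp (-((1 + Complex.I) * resolventSymbol k ξ) * s) * 𝓕 θ ξ :=
        (integral_integral_swap hi2).symm
    -- The ray integral of `exp (-t σ(ξ))` is `1 / σ(ξ)`, cancelling the symbol that the operator
    -- put in front of `𝓕 φ`.
    _ = ∫ ξ : Space N, 𝓕 φ ξ := by
        refine integral_congr_ae (Filter.Eventually.of_forall fun ξ => ?_)
        have hneg : (-((1 + Complex.I) * resolventSymbol k ξ)).re < 0 := by
          rw [ray_mul_resolventSymbol_re]
          have : 0 < 4 * Real.pi ^ 2 * ‖ξ‖ ^ 2 + k := by positivity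
          linarith
        simp only []
        rw [integral_mul_const, integral_const_mul, integral_exp_mul_complex_Ioi hneg,
          hθ, fourier_resolventOp_apply]
        have h1 := resolventSymbol_ne_zero hk ξ
        have h2 : (1 + Complex.I : ℂ) ≠ 0 := left_ne_zero_of_mul (ray_ne_zero one_pos)
        simp only [Complex.ofReal_zero, mul_zero, Complex.exp_zero]
        field_simp
    _ = φ 0 := by
        have h : 𝓕⁻ (𝓕 φ) 0 = φ 0 := by rw [fourierInv_fourier_eq]
        rw [← h, fourierInv_coe, Real.fourierInv_eq]
        simp

end Distributional

/-! ### Real and imaginary parts: identities for `G_k` -/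

section KernelIdentities

open SchwartzMap

lemma ae_ne_zero {N : ℕ} (hN : 1 ≤ N) : ∀ᵐ x : Space N, x ≠ 0 := by
  have : Nonempty (Fin N) := ⟨⟨0, hN⟩⟩
  exact Measure.ae_ne volume 0

lemma laplacian_greenFn_ae {N : ℕ} (hN : 1 ≤ N) {k : ℝ} (hk : 0 < k) :
    Δ (greenFn (N := N) k) =ᵐ[volume] fun x => -(resolventKernel k x).re := by
  filter_upwards [ae_ne_zero hN] with x hx
  exact laplacian_greenFn hk hx

lemma memLp_greenFn {N : ℕ} {k q : ℝ} (hk : 0 < k) (hq : 1 ≤ q)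
    (hqN : (N : ℝ) / 2 - N / (2 * q) < 1) : MemLp (greenFn (N := N) k) (ENNReal.ofReal q) := by
  rw [greenFn_eq_scaledIm_comp]
  exact (scaledIm k).comp_memLp' (memLp_resolventKernel hk hq hqN)

lemma memLp_laplacian_greenFn {N : ℕ} (hN : 1 ≤ N) {k q : ℝ} (hk : 0 < k) (hq : 1 ≤ q)
    (hqN : (N : ℝ) / 2 - N / (2 * q) < 1) :
    MemLp (Δ (greenFn (N := N) k)) (ENNReal.ofReal q) := by
  rw [memLp_congr_ae (laplacian_greenFn_ae hN hk)]
  exact (Complex.reCLM.comp_memLp' (memLp_resolventKernel hk hq hqN)).neg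

lemma integrable_greenFn {N : ℕ} {k : ℝ} (hk : 0 < k) : Integrable (greenFn (N := N) k) := by
  rw [greenFn_eq_scaledIm_comp]
  exact (scaledIm k).integrable_comp (integrable_resolventKernel hk)

lemma integrable_laplacian_greenFn {N : ℕ} (hN : 1 ≤ N) {k : ℝ} (hk : 0 < k) :
    Integrable (Δ (greenFn (N := N) k)) := by
  rw [integrable_congr (laplacian_greenFn_ae hN hk)]
  exact (Complex.reCLM.integrable_comp (integrable_resolventKernel hk)).neg

lemma integrable_mul_schwartz {N : ℕ} {g : Space N → ℝ} (hg : Integrable g) (φ : 𝓢(Space N, ℝ)) :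
    Integrable fun x => g x * φ x :=
  hg.mul_bdd (c := SchwartzMap.seminorm ℝ 0 0 φ) φ.continuous.aestronglyMeasurable
    (Filter.Eventually.of_forall fun x => norm_le_seminorm ℝ φ x)

/-- A real Schwartz function, seen as a complex one. -/
noncomputable def complexify {N : ℕ} (φ : 𝓢(Space N, ℝ)) : 𝓢(Space N, ℂ) :=
  postcompCLM Complex.ofRealCLM φ

lemma complexify_apply {N : ℕ} (φ : 𝓢(Space N, ℝ)) (x : Space N) :
    complexify φ x = (φ x : ℂ) := rfl

lemma laplacian_complexify {N : ℕ} (φ : 𝓢(Space N, ℝ)) (x : Space N) :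
    Δ (complexify φ) x = (Δ φ x : ℂ) := by
  rw [laplacian_apply, laplacian_apply]
  exact (φ.contDiffAt 2).laplacian_CLM_comp_left (l := Complex.ofRealCLM)

lemma resolventOp_complexify_apply {N : ℕ} (k : ℝ) (φ : 𝓢(Space N, ℝ)) (x : Space N) :
    resolventOp k (complexify φ) x = -(Δ φ x : ℂ) - Complex.I * k * φ x := by
  rw [resolventOp, sub_apply, neg_apply, smul_apply,
    laplacian_complexify, complexify_apply, smul_eq_mul]

lemma integrable_resolventKernel_mul {N : ℕ} {k : ℝ} (hk : 0 < k) (θ : 𝓢(Space N, ℂ)) :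
    Integrable fun x => resolventKernel k x * θ x :=
  (integrable_resolventKernel hk).mul_bdd (c := SchwartzMap.seminorm ℝ 0 0 θ)
    θ.continuous.aestronglyMeasurable (Filter.Eventually.of_forall fun x => norm_le_seminorm ℝ θ x)

/-- The classical Laplacian of `greenFn` away from the origin is its distributional Laplacian. -/
theorem integral_greenFn_mul_laplacian {N : ℕ} (hN : 1 ≤ N) {k : ℝ} (hk : 0 < k)
    (φ : 𝓢(Space N, ℝ)) :
    ∫ x, greenFn k x * Δ φ x = ∫ x, Δ (greenFn k) x * φ x := by
  -- The test function is real, so the right-hand side `φ 0` has imaginary part 0.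
  have h := congrArg (scaledIm k) (integral_resolventKernel_mul hk (complexify φ))
  rw [← (scaledIm k).integral_comp_comm (integrable_resolventKernel_mul hk _)] at h
  have h' : ∫ x, (greenFn k x * Δ φ x - Δ (greenFn k) x * φ x) = 0 := by
    rw [← neg_eq_zero, ← integral_neg]
    convert h using 1
    · refine integral_congr_ae ?_
      filter_upwards [ae_ne_zero hN] with x hx
      rw [laplacian_greenFn hk hx, greenFn_eq_scaledIm_comp, Function.comp_apply,
        resolventOp_complexify_apply, scaledIm_apply, scaledIm_apply]
      have : (resolventKernel k x * (-(Δ φ x : ℂ) - Complex.I * k * φ x)).im =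
          -(resolventKernel k x).im * Δ φ x - k * ((resolventKernel k x).re * φ x) := by
        simp; ring
      rw [this]
      field_simp
      ring
    · simp [complexify_apply, scaledIm_apply]
  rw [integral_sub (integrable_mul_schwartz (integrable_greenFn hk) (Δ φ))
    (integrable_mul_schwartz (integrable_laplacian_greenFn hN hk) φ)] at h'
  linarith

/-- `Δ (Δ G) + k² G = δ₀` in the sense of distributions. -/
theorem integral_laplacian_greenFn_mul_laplacian {N : ℕ} (hN : 1 ≤ N) {k : ℝ} (hk : 0 < k)
    (φ : 𝓢(Space N, ℝ)) :
    (∫ x, Δ (greenFn k) x * Δ φ x) + k ^ 2 * ∫ x, greenFn k x * φ x = φ 0 := by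
  have h := congrArg Complex.reCLM (integral_resolventKernel_mul hk (complexify φ))
  rw [← Complex.reCLM.integral_comp_comm (integrable_resolventKernel_mul hk _)] at h
  rw [← integral_const_mul, ← integral_add
    (integrable_mul_schwartz (integrable_laplacian_greenFn hN hk) (Δ φ))
    ((integrable_mul_schwartz (integrable_greenFn hk) φ).const_mul _)]
  convert h using 1
  · refine integral_congr_ae ?_
    filter_upwards [ae_ne_zero hN] with x hx
    rw [laplacian_greenFn hk hx, greenFn_eq_scaledIm_comp, Function.comp_apply,
      resolventOp_complexify_apply, scaledIm_apply]
    have : Complex.reCLM (resolventKernel k x * (-(Δ φ x : ℂ) - Complex.I * k * φ x)) =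
        -(resolventKernel k x).re * Δ φ x + k * ((resolventKernel k x).im * φ x) := by
      simp; ring
    rw [this]
    field_simp
  · simp [complexify_apply]

lemma integrable_coord_smul_resolventProfile {N : ℕ} {k : ℝ} (hk : 0 < k) (i : Fin N) :
    Integrable fun x : Space N => (2 * x i) • resolventProfile N k 1 (‖x‖ ^ 2) := by
  have h := (integrable_coord_smul_resolventIntegrand_prod hk i).integral_prod_left
  simp only [integral_smul] at h
  exact h

lemma partialDeriv_greenFn_ae {N : ℕ} (hN : 1 ≤ N) {k : ℝ} (hk : 0 < k) (i : Fin N) :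
    partialDeriv i (greenFn k) =ᵐ[volume]
      fun x => scaledIm k ((2 * x i) • resolventProfile N k 1 (‖x‖ ^ 2)) := by
  filter_upwards [ae_ne_zero hN] with x hx
  exact partialDeriv_greenFn hk i hx

lemma integrable_partialDeriv_greenFn {N : ℕ} (hN : 1 ≤ N) {k : ℝ} (hk : 0 < k) (i : Fin N) :
    Integrable (partialDeriv i (greenFn k)) := by
  rw [integrable_congr (partialDeriv_greenFn_ae hN hk i)]
  exact (scaledIm k).integrable_comp (integrable_coord_smul_resolventProfile hk i)

lemma hasFDerivAt_resolventIntegrand_norm_sq (N : ℕ) (k s : ℝ) (x : Space N) :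
    HasFDerivAt (fun y : Space N => resolventIntegrand N k 0 (‖y‖ ^ 2) s)
      ((2 • innerSL ℝ x).smulRight (resolventIntegrand N k 1 (‖x‖ ^ 2) s)) x :=
  hasFDerivAt_comp_norm_sq (P := fun ρ => resolventIntegrand N k 0 ρ s)
    (hasDerivAt_resolventIntegrand N k 0 _ s)

lemma continuous_resolventIntegrand_norm_sq (N : ℕ) (k : ℝ) (m : ℕ) (s : ℝ) :
    Continuous fun y : Space N => resolventIntegrand N k m (‖y‖ ^ 2) s := by
  unfold resolventIntegrand
  fun_prop

/-- For fixed `s` the integrand is smooth on all of `ℝ^N`, so integration by parts leaves nothing at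
the origin. The singularity arises only after integrating in `s`, which Fubini postpones. -/
lemma integral_coord_smul_resolventIntegrand_mul {N : ℕ} (k s : ℝ) (i : Fin N) {φ : Space N → ℂ}
    (hφ : ContDiff ℝ 1 φ) (hc : HasCompactSupport φ) :
    ∫ x : Space N, ((2 * x i) • resolventIntegrand N k 1 (‖x‖ ^ 2) s) * φ x =
      -∫ x : Space N, resolventIntegrand N k 0 (‖x‖ ^ 2) s *
        fderiv ℝ φ x (EuclideanSpace.single i 1) := by
  have hd := hasFDerivAt_resolventIntegrand_norm_sq N k s
  have h0 := continuous_resolventIntegrand_norm_sq N k 0 s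
  have h1 := continuous_resolventIntegrand_norm_sq N k 1 s
  have hfd : ∀ x : Space N, fderiv ℝ (fun y : Space N => resolventIntegrand N k 0 (‖y‖ ^ 2) s) x
      (EuclideanSpace.single i 1) = (2 * x i) • resolventIntegrand N k 1 (‖x‖ ^ 2) s := by
    intro x
    rw [(hd x).fderiv]
    simp [EuclideanSpace.inner_single_right]
  have hφ' : Continuous fun x => fderiv ℝ φ x (EuclideanSpace.single i 1) :=
    (hφ.continuous_fderiv (by norm_num)).clm_apply continuous_const
  rw [integral_mul_fderiv_eq_neg_fderiv_mul_of_integrable, neg_neg]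
  · simp only [hfd]
  · simp only [hfd]
    refine Continuous.integrable_of_hasCompactSupport ?_ hc.mul_left
    have hx : Continuous fun x : Space N => 2 * x i := by fun_prop
    exact (hx.smul h1).mul hφ.continuous
  · exact (h0.mul hφ').integrable_of_hasCompactSupport
      (hc.fderiv_apply ℝ (EuclideanSpace.single i 1)).mul_left
  · exact (h0.mul hφ.continuous).integrable_of_hasCompactSupport hc.mul_left
  · exact fun x _ => (hd x).differentiableAt
  · exact fun x _ => (hφ.differentiable (by norm_num)) x

lemma integral_coord_smul_resolventProfile_mul {N : ℕ} {k : ℝ} (hk : 0 < k) (i : Fin N)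
    {φ : Space N → ℂ} (hφ : ContDiff ℝ 1 φ) (hc : HasCompactSupport φ) :
    ∫ x : Space N, ((2 * x i) • resolventProfile N k 1 (‖x‖ ^ 2)) * φ x =
      -∫ x : Space N, resolventKernel k x * fderiv ℝ φ x (EuclideanSpace.single i 1) := by
  have hφ' : Continuous fun x => fderiv ℝ φ x (EuclideanSpace.single i 1) :=
    (hφ.continuous_fderiv (by norm_num)).clm_apply continuous_const
  obtain ⟨C, hC⟩ := hc.exists_bound_of_continuous hφ.continuous
  obtain ⟨C', hC'⟩ := (hc.fderiv_apply ℝ (EuclideanSpace.single i 1)).exists_bound_of_continuous hφ'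
  have hi1 := (integrable_coord_smul_resolventIntegrand_prod hk i).mul_bdd (c := C)
    (hφ.continuous.comp continuous_fst).aestronglyMeasurable
    (Filter.Eventually.of_forall fun z => hC z.1)
  have hi0 := (integrable_resolventIntegrand_prod (N := N) hk).mul_bdd (c := C')
    (hφ'.comp continuous_fst).aestronglyMeasurable
    (Filter.Eventually.of_forall fun z => hC' z.1)
  calc ∫ x : Space N, ((2 * x i) • resolventProfile N k 1 (‖x‖ ^ 2)) * φ x
      = ∫ x : Space N, ∫ s in Set.Ioi (0 : ℝ),
          ((2 * x i) • resolventIntegrand N k 1 (‖x‖ ^ 2) s) * φ x := by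
        simp_rw [integral_mul_const, integral_smul]; rfl
    _ = ∫ s in Set.Ioi (0 : ℝ), ∫ x : Space N,
          ((2 * x i) • resolventIntegrand N k 1 (‖x‖ ^ 2) s) * φ x := integral_integral_swap hi1
    _ = -∫ s in Set.Ioi (0 : ℝ), ∫ x : Space N, resolventIntegrand N k 0 (‖x‖ ^ 2) s *
        fderiv ℝ φ x (EuclideanSpace.single i 1) := by
        simp_rw [integral_coord_smul_resolventIntegrand_mul k _ i hφ hc]
        exact integral_neg _
    _ = -∫ x : Space N, ∫ s in Set.Ioi (0 : ℝ), resolventIntegrand N k 0 (‖x‖ ^ 2) s *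
        fderiv ℝ φ x (EuclideanSpace.single i 1) := by
        rw [← integral_integral_swap hi0]
    _ = _ := by
        simp_rw [integral_mul_const]; rfl

/-- The classical partial derivatives of `greenFn` away from the origin are its distributional
partial derivatives. -/
theorem integral_partialDeriv_greenFn_mul {N : ℕ} (hN : 1 ≤ N) {k : ℝ} (hk : 0 < k) (i : Fin N)
    {φ : Space N → ℝ} (hφ : IsTest φ) :
    ∫ x, greenFn k x * partialDeriv i φ x = -∫ x, partialDeriv i (greenFn k) x * φ x := by
  have hφ1 : ContDiff ℝ 1 φ := hφ.1.of_le (by exact_mod_cast le_top)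
  have hd := hφ1.differentiable (by norm_num)
  have hψ : ContDiff ℝ 1 (fun x => (φ x : ℂ)) := Complex.ofRealCLM.contDiff.comp hφ1
  have hψc : HasCompactSupport (fun x => (φ x : ℂ)) :=
    hφ.2.comp_left (g := fun r : ℝ => (r : ℂ)) Complex.ofReal_zero
  have hfd : ∀ x, fderiv ℝ (fun x => (φ x : ℂ)) x (EuclideanSpace.single i 1) =
      (partialDeriv i φ x : ℂ) := by
    intro x
    have : HasFDerivAt (fun x => (φ x : ℂ)) (Complex.ofRealCLM.comp (fderiv ℝ φ x)) x :=
      Complex.ofRealCLM.hasFDerivAt.comp x (hd x).hasFDerivAt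
    rw [this.fderiv]
    rfl
  have hφ' : Continuous (partialDeriv i φ) :=
    (hφ1.continuous_fderiv (by norm_num)).clm_apply continuous_const
  obtain ⟨C, hC⟩ := hψc.exists_bound_of_continuous hψ.continuous
  obtain ⟨C', hC'⟩ := (hφ.2.fderiv_apply ℝ (EuclideanSpace.single i 1)).exists_bound_of_continuous
    hφ'
  have h := congrArg (scaledIm k) (integral_coord_smul_resolventProfile_mul hk i hψ hψc)
  simp only [hfd] at h
  rw [map_neg, ← (scaledIm k).integral_comp_comm, ← (scaledIm k).integral_comp_comm] at h
  · rw [eq_neg_iff_add_eq_zero, add_comm, ← eq_neg_iff_add_eq_zero]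
    convert h using 1
    · refine integral_congr_ae ?_
      filter_upwards [partialDeriv_greenFn_ae hN hk i] with x hx
      rw [hx, scaledIm_apply, scaledIm_apply, Complex.im_mul_ofReal]
      ring
    · congr 1
      refine integral_congr_ae (Filter.Eventually.of_forall fun x => ?_)
      simp only []
      rw [greenFn_eq_scaledIm_comp, Function.comp_apply, scaledIm_apply, scaledIm_apply,
        Complex.im_mul_ofReal]
      ring
  · exact (integrable_resolventKernel hk).mul_bdd (c := C')
      (Complex.continuous_ofReal.comp hφ').aestronglyMeasurable
      (Filter.Eventually.of_forall fun x => by rw [Complex.norm_real]; exact hC' x)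
  · exact (integrable_coord_smul_resolventProfile hk i).mul_bdd (c := C)
      hψ.continuous.aestronglyMeasurable (Filter.Eventually.of_forall hC)

end KernelIdentities

/-! ### From an `L²` Laplacian to `H²` -/

section Sobolev

open SchwartzMap TemperedDistribution LineDeriv
open scoped FourierTransform

variable {N : ℕ}

lemma HasWeakPartialDeriv.congr_left {i : Fin N} {u u' v : Space N → ℝ}
    (h : HasWeakPartialDeriv i u v) (hu : u =ᵐ[volume] u') : HasWeakPartialDeriv i u' v := by
  refine ⟨h.1.congr hu, h.2.1, fun φ hφ => ?_⟩
  rw [← h.2.2 φ hφ]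
  refine integral_congr_ae ?_
  filter_upwards [hu] with x hx
  rw [hx]

lemma integrable_schwartz_smul_Lp (a : Lp ℂ 2 (volume : Measure (Space N))) (θ : 𝓢(Space N, ℂ)) :
    Integrable fun x => θ x • a x :=
  (θ.memLp 2).integrable_mul (Lp.memLp a)

lemma re_integral_complexify_smul_Lp (a : Lp ℂ 2 (volume : Measure (Space N)))
    (φ : 𝓢(Space N, ℝ)) :
    (∫ x, complexify φ x • a x).re = ∫ x, (a x).re * φ x := by
  have h := Complex.reCLM.integral_comp_comm (integrable_schwartz_smul_Lp a (complexify φ))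
  rw [Complex.reCLM_apply] at h
  rw [← h]
  refine integral_congr_ae (Filter.Eventually.of_forall fun x => ?_)
  simp [complexify_apply, mul_comm]

lemma lineDerivOp_complexify (φ : 𝓢(Space N, ℝ)) (m : Space N) :
    ∂_{m} (complexify φ) = complexify (∂_{m} φ) := by
  ext x
  rw [complexify_apply, SchwartzMap.lineDerivOp_apply_eq_fderiv,
    SchwartzMap.lineDerivOp_apply_eq_fderiv]
  have : HasFDerivAt (complexify φ) (Complex.ofRealCLM.comp (fderiv ℝ φ x)) x :=
    Complex.ofRealCLM.hasFDerivAt.comp x φ.differentiableAt.hasFDerivAt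
  rw [this.fderiv]
  rfl

/-- A distributional derivative of an `L²` function which lies in `L²` is a weak derivative. -/
lemma hasWeakPartialDeriv_re {i : Fin N} {a b : Lp ℂ 2 (volume : Measure (Space N))}
    (h : ∂_{(EuclideanSpace.single i 1 : Space N)} (a : 𝓢'(Space N, ℂ)) = (b : 𝓢'(Space N, ℂ))) :
    HasWeakPartialDeriv i (fun x => (a x).re) (fun x => (b x).re) := by
  refine ⟨(Lp.memLp a).re.locallyIntegrable (by norm_num),
    (Lp.memLp b).re.locallyIntegrable (by norm_num), fun φ hφ => ?_⟩
  set ψ : 𝓢(Space N, ℝ) := hφ.2.toSchwartzMap hφ.1 with hψ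
  have h1 := DFunLike.congr_fun h (complexify ψ)
  rw [TemperedDistribution.lineDerivOp_apply_apply, map_neg, Lp.toTemperedDistribution_apply,
    Lp.toTemperedDistribution_apply, lineDerivOp_complexify] at h1
  have h2 := congrArg Complex.re h1
  rw [Complex.neg_re, re_integral_complexify_smul_Lp, re_integral_complexify_smul_Lp] at h2
  rw [← neg_eq_iff_eq_neg]
  refine Eq.trans (congrArg Neg.neg (integral_congr_ae (Filter.Eventually.of_forall fun x => ?_))) h2
  simp only [SchwartzMap.lineDerivOp_apply_eq_fderiv]
  rfl

/-- At order two the symbol `(1 + |ξ|²)^{2/2}` is a polynomial, and `|ξ|²` is the symbol of `-(2π)⁻²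
Δ`. -/
lemma besselPotential_two_eq (f : 𝓢'(Space N, ℂ)) :
    besselPotential (Space N) ℂ 2 f = f - ((2 * Real.pi) ^ 2)⁻¹ • Δ f := by
  have h1 : (fun _ : Space N => (1 : ℂ)).HasTemperateGrowth := by fun_prop
  have h2 : (fun x : Space N => Complex.ofReal (‖x‖ ^ 2)).HasTemperateGrowth := by fun_prop
  have hfun : (fun x : Space N => (((1 + ‖x‖ ^ 2) ^ ((2 : ℝ) / 2) : ℝ) : ℂ)) =
      (fun _ => (1 : ℂ)) + fun x => Complex.ofReal (‖x‖ ^ 2) := by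
    ext x
    simp
  rw [TemperedDistribution.laplacian_eq_fourierMultiplierCLM, besselPotential, hfun,
    TemperedDistribution.fourierMultiplierCLM_apply, TemperedDistribution.smulLeftCLM_add h1 h2,
    add_apply, FourierTransform.fourierInv_add,
    ← TemperedDistribution.fourierMultiplierCLM_apply,
    ← TemperedDistribution.fourierMultiplierCLM_apply,
    TemperedDistribution.fourierMultiplierCLM_const]
  have hpi : ((2 * Real.pi) ^ 2 : ℝ) ≠ 0 := by positivity
  rw [neg_smul, smul_neg, sub_neg_eq_add, smul_smul, inv_mul_cancel₀ hpi, one_smul]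
  simp

lemma memLp_ofReal {u : Space N → ℝ} (hu : MemLp u 2) : MemLp (fun x => (u x : ℂ)) 2 :=
  hu.ofReal

/-- A real `L²` function as an element of the complex space `L²`. -/
noncomputable def complexLp {u : Space N → ℝ} (hu : MemLp u 2) :
    Lp ℂ 2 (volume : Measure (Space N)) :=
  (memLp_ofReal hu).toLp _

lemma coeFn_complexLp {u : Space N → ℝ} (hu : MemLp u 2) :
    complexLp hu =ᵐ[volume] fun x => (u x : ℂ) :=
  (memLp_ofReal hu).coeFn_toLp

/-- Splitting `θ` into real and imaginary parts lets identities known only for real Schwartz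
functions determine a complex distribution. -/
lemma integral_smul_complexLp {u : Space N → ℝ} (hu : MemLp u 2) (θ : 𝓢(Space N, ℂ)) :
    ∫ x, θ x • complexLp hu x =
      ((∫ x, u x * postcompCLM Complex.reCLM θ x : ℝ) : ℂ) +
        ((∫ x, u x * postcompCLM Complex.imCLM θ x : ℝ) : ℂ) * Complex.I := by
  have h1 : ∫ x, θ x • complexLp hu x = ∫ x, θ x * (u x : ℂ) := by
    refine integral_congr_ae ?_
    filter_upwards [coeFn_complexLp hu] with x hx
    rw [hx, smul_eq_mul]
  have hi : Integrable fun x => θ x * (u x : ℂ) := (θ.memLp 2).integrable_mul (memLp_ofReal hu)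
  have hre := Complex.reCLM.integral_comp_comm hi
  have him := Complex.imCLM.integral_comp_comm hi
  rw [h1]
  refine Complex.ext ?_ ?_
  · rw [← Complex.reCLM_apply, ← hre]
    simp [postcompCLM_apply, mul_comm]
  · rw [← Complex.imCLM_apply, ← him]
    simp [postcompCLM_apply, mul_comm]

lemma laplacian_postcompCLM (L : ℂ →L[ℝ] ℝ) (θ : 𝓢(Space N, ℂ)) :
    Δ (postcompCLM L θ) = postcompCLM L (Δ θ) := by
  ext x
  rw [postcompCLM_apply, laplacian_apply, laplacian_apply]
  exact (θ.contDiffAt 2).laplacian_CLM_comp_left (l := L)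

/-- If `u` and its weak Laplacian are in `L²`, then `u ∈ H²`. -/
theorem memH2_of_laplacian {u w : Space N → ℝ} (hu : MemLp u 2) (hw : MemLp w 2)
    (h : ∀ φ : 𝓢(Space N, ℝ), ∫ x, u x * Δ φ x = ∫ x, w x * φ x) : MemH2 u := by
  set U := complexLp hu
  set W := complexLp hw
  have hlap : Δ (U : 𝓢'(Space N, ℂ)) = (W : 𝓢'(Space N, ℂ)) := by
    ext θ
    rw [TemperedDistribution.laplacian_apply_apply, Lp.toTemperedDistribution_apply,
      Lp.toTemperedDistribution_apply, integral_smul_complexLp, integral_smul_complexLp,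
      ← laplacian_postcompCLM, ← laplacian_postcompCLM, h, h]
  have hS : MemSobolev 2 2 (U : 𝓢'(Space N, ℂ)) := by
    refine ⟨U - (((2 * Real.pi) ^ 2)⁻¹ : ℝ) • W, ?_⟩
    rw [besselPotential_two_eq, hlap, ← Lp.toTemperedDistributionCLM_apply,
      ← Lp.toTemperedDistributionCLM_apply, ← Lp.toTemperedDistributionCLM_apply, map_sub,
      ContinuousLinearMap.map_smul_of_tower]
  have hUu : (fun x => (U x).re) =ᵐ[volume] u := by
    filter_upwards [coeFn_complexLp hu] with x hx
    rw [hx, Complex.ofReal_re]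
  refine ⟨hu, fun i => ?_⟩
  -- Each derivative lowers the Sobolev order by one, so two of them still leave an `L²` function.
  have hS1 := hS.lineDerivOp (m := (EuclideanSpace.single i 1 : Space N))
  obtain ⟨v, hv⟩ := memSobolev_zero_iff.1 (hS1.mono (s' := 0) (by norm_num))
  refine ⟨fun x => (v x).re, (Lp.memLp v).re, (hasWeakPartialDeriv_re hv).congr_left hUu,
    fun j => ?_⟩
  rw [hv] at hS1
  have hS2 := hS1.lineDerivOp (m := (EuclideanSpace.single j 1 : Space N))
  obtain ⟨w', hw'⟩ := memSobolev_zero_iff.1 (hS2.mono (s' := 0) (by norm_num))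
  exact ⟨fun x => (w' x).re, (Lp.memLp w').re, hasWeakPartialDeriv_re hw'⟩

end Sobolev

/-! ### Transfer to convolutions with `f` -/

section Solution

open SchwartzMap

variable {N : ℕ}

/-- The translate `y ↦ φ (y + z)` of a Schwartz function. -/
noncomputable def translate (z : Space N) (φ : 𝓢(Space N, ℝ)) : 𝓢(Space N, ℝ) :=
  compSubConstCLM ℝ (-z) φ

lemma translate_apply (z : Space N) (φ : 𝓢(Space N, ℝ)) (y : Space N) :
    translate z φ y = φ (y + z) := by
  rw [translate, compSubConstCLM_apply, sub_neg_eq_add]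

lemma laplacian_translate_apply (z : Space N) (φ : 𝓢(Space N, ℝ)) (y : Space N) :
    Δ (translate z φ) y = Δ φ (y + z) := by
  have h : ⇑(translate z φ) = fun y => φ (y + z) := funext (translate_apply z φ)
  rw [laplacian_apply, laplacian_apply, h]
  simp only [InnerProductSpace.laplacian_eq_iteratedFDeriv_stdOrthonormalBasis,
    iteratedFDeriv_comp_add_right]

lemma IsTest.comp_add_right {φ : Space N → ℝ} (hφ : IsTest φ) (z : Space N) :
    IsTest fun y => φ (y + z) :=
  ⟨hφ.1.comp (contDiff_id.add contDiff_const),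
    hφ.2.comp_homeomorph (Homeomorph.addRight z)⟩

lemma partialDeriv_comp_add_right (i : Fin N) (φ : Space N → ℝ) (z y : Space N) :
    partialDeriv i (fun y => φ (y + z)) y = partialDeriv i φ (y + z) := by
  simp only [partialDeriv, fderiv_comp_add_right]

/-- A test function as a Schwartz function. -/
noncomputable def IsTest.toSchwartz {φ : Space N → ℝ} (hφ : IsTest φ) : 𝓢(Space N, ℝ) :=
  hφ.2.toSchwartzMap hφ.1

lemma IsTest.coe_toSchwartz {φ : Space N → ℝ} (hφ : IsTest φ) : ⇑hφ.toSchwartz = φ := rfl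

lemma IsTest.laplacian {φ : Space N → ℝ} (hφ : IsTest φ) :
    Δ φ = ⇑(Δ hφ.toSchwartz : 𝓢(Space N, ℝ)) :=
  funext fun x => by rw [laplacian_apply, hφ.coe_toSchwartz]

/-- The distributional Laplacian identity, tested with `Δψ`, moves the second Laplacian from `G_k`
onto the test function. -/
theorem isFundamentalSolution_greenFn (hN : 1 ≤ N) {k : ℝ} (hk : 0 < k) :
    IsFundamentalSolution k (greenFn (N := N) k) where
  integrable := integrable_greenFn hk
  contDiffOn := contDiffOn_greenFn hk 2
  eq_dirac φ hφ := by
    set ψ := hφ.toSchwartz with hψ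
    have h := integral_laplacian_greenFn_mul_laplacian hN hk ψ
    rw [← integral_greenFn_mul_laplacian hN hk (Δ ψ), ← integral_const_mul, ← integral_add
      (integrable_mul_schwartz (integrable_greenFn hk) (Δ (Δ ψ)))
      ((integrable_mul_schwartz (integrable_greenFn hk) ψ).const_mul _)] at h
    rw [hφ.laplacian, show φ 0 = ψ 0 from rfl, ← h]
    refine integral_congr_ae (Filter.Eventually.of_forall fun x => ?_)
    have hφx : ψ x = φ x := by rw [hψ, hφ.coe_toSchwartz]
    simp only [← hψ, laplacian_apply (Δ ψ), hφx]
    ring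

variable {f : Space N → ℝ} {k : ℝ}

/-- The weak Laplacian of `T_k f`, tested with Schwartz functions. -/
lemma integral_opT_mul_laplacian (hN : 1 ≤ N) (hk : 0 < k) (hf : AEStronglyMeasurable f volume)
    (hG : ∫⁻ x, absConv f (greenFn k) x ^ (2 : ℝ) < ⊤)
    (hD : ∫⁻ x, absConv f (Δ (greenFn k)) x ^ (2 : ℝ) < ⊤) (φ : 𝓢(Space N, ℝ)) :
    ∫ x, opT k f x * Δ φ x = ∫ x, opSLap k f x * φ x := by
  rw [opT, opSLap, integral_conv_mul one_le_two hf (integrable_greenFn hk).1 hG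
      (Δ φ).integrable (norm_le_seminorm ℝ (Δ φ)),
    integral_conv_mul one_le_two hf (integrable_laplacian_greenFn hN hk).1 hD
      φ.integrable (norm_le_seminorm ℝ φ)]
  refine integral_congr_ae (Filter.Eventually.of_forall fun z => ?_)
  have h := integral_greenFn_mul_laplacian hN hk (translate z φ)
  simp only [laplacian_translate_apply, translate_apply] at h
  simp only [h]

/-- `Δ² T_k f + k² T_k f = f`, tested with Schwartz functions. -/
lemma integral_opSLap_mul_laplacian (hN : 1 ≤ N) (hk : 0 < k) (hf : AEStronglyMeasurable f volume)
    (hG : ∫⁻ x, absConv f (greenFn k) x ^ (2 : ℝ) < ⊤)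
    (hD : ∫⁻ x, absConv f (Δ (greenFn k)) x ^ (2 : ℝ) < ⊤) (φ : 𝓢(Space N, ℝ)) :
    Integrable (fun x => f x * φ x) ∧
    (∫ x, opSLap k f x * Δ φ x) + k ^ 2 * ∫ x, opT k f x * φ x = ∫ x, f x * φ x := by
  have hGm := (integrable_greenFn (N := N) hk).1
  have hDm := (integrable_laplacian_greenFn hN hk).1
  have hi1 := integrable_conv_pairing one_le_two hf hDm hD (Δ φ).integrable
    (norm_le_seminorm ℝ (Δ φ))
  have hi2 := (integrable_conv_pairing one_le_two hf hGm hG φ.integrable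
    (norm_le_seminorm ℝ φ)).const_mul (k ^ 2)
  -- The kernel identity is tested with the translate of `φ` by `z`, whose value at 0 is `φ z`.
  have hz : ∀ z, f z * (∫ y, Δ (greenFn k) y * Δ φ (y + z)) +
      k ^ 2 * (f z * ∫ y, greenFn k y * φ (y + z)) = f z * φ z := by
    intro z
    have h := integral_laplacian_greenFn_mul_laplacian hN hk (translate z φ)
    simp only [laplacian_translate_apply, translate_apply, zero_add] at h
    rw [← h]
    ring
  -- Integrability of `f φ` comes for free: it is the sum of two integrable pairings.
  refine ⟨(hi1.add hi2).congr (Filter.Eventually.of_forall hz), ?_⟩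
  rw [opT, opSLap, integral_conv_mul one_le_two hf hGm hG φ.integrable (norm_le_seminorm ℝ φ),
    integral_conv_mul one_le_two hf hDm hD (Δ φ).integrable (norm_le_seminorm ℝ (Δ φ)),
    ← integral_const_mul, ← integral_add hi1 hi2]
  exact integral_congr_ae (Filter.Eventually.of_forall hz)

/-- The two convolutions are controlled with different exponents, 2 for `T_k f` and `p` for `S^i_k
f`; local integrability and Fubini require no more. -/
lemma hasWeakPartialDeriv_opT (hN : 1 ≤ N) (hk : 0 < k) (hf : AEStronglyMeasurable f volume)
    (hG : ∫⁻ x, absConv f (greenFn k) x ^ (2 : ℝ) < ⊤) {p : ℝ} (hp : 1 ≤ p) (i : Fin N)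
    (hP : ∫⁻ x, absConv f (partialDeriv i (greenFn k)) x ^ p < ⊤) :
    HasWeakPartialDeriv i (opT k f) (opS k i f) := by
  have hGm := (integrable_greenFn (N := N) hk).1
  have hPm := (integrable_partialDeriv_greenFn hN hk i).1
  refine ⟨(memLp_conv one_le_two hf hGm hG).locallyIntegrable (by simp),
    (memLp_conv hp hf hPm hP).locallyIntegrable (by simpa using hp), fun φ hφ => ?_⟩
  have hφ' : Continuous (partialDeriv i φ) :=
    (hφ.1.continuous_fderiv (by simp)).clm_apply continuous_const
  have hφc' : HasCompactSupport (partialDeriv i φ) :=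
    hφ.2.fderiv_apply ℝ (EuclideanSpace.single i 1)
  obtain ⟨C, hC⟩ := hφ.2.exists_bound_of_continuous hφ.1.continuous
  obtain ⟨C', hC'⟩ := hφc'.exists_bound_of_continuous hφ'
  rw [opT, opS, integral_conv_mul one_le_two hf hGm hG
      (hφ'.integrable_of_hasCompactSupport hφc') hC',
    integral_conv_mul hp hf hPm hP (hφ.1.continuous.integrable_of_hasCompactSupport hφ.2) hC,
    ← integral_neg]
  refine integral_congr_ae (Filter.Eventually.of_forall fun z => ?_)
  have h := integral_partialDeriv_greenFn_mul hN hk i (hφ.comp_add_right z)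
  simp only [partialDeriv_comp_add_right] at h
  simp only [h, mul_neg]

end Solution

end Biharmonic

/-! ### The choice of exponents and the conclusion -/

theorem theorem4p2 (N : ℕ) (hN : 1 ≤ N) (k lam : ℝ) (hk : 0 < k) (hlam : lam = -k ^ 2)
    (p : ℝ) (hp_one : 1 ≤ p) (hp_lower : 2 * (N : ℝ) / ((N : ℝ) + 4) < p) (hp_upper : p ≤ 2)
    (f : Biharmonic.Space N → ℝ) (hf : MemLp f (ENNReal.ofReal p) volume) :
    Biharmonic.IsFundamentalSolution k (Biharmonic.greenFn (N := N) k) ∧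
    Biharmonic.ConvExistsAE f (Biharmonic.greenFn k) ∧
    (∀ i : Fin N,
      Biharmonic.ConvExistsAE f (Biharmonic.partialDeriv i (Biharmonic.greenFn k))) ∧
    Biharmonic.ConvExistsAE f (Δ (Biharmonic.greenFn k)) ∧
    Biharmonic.MemH2 (Biharmonic.opT k f) ∧
    (∀ i : Fin N,
      Biharmonic.HasWeakPartialDeriv i (Biharmonic.opT k f) (Biharmonic.opS k i f)) ∧
    Biharmonic.HasWeakLaplacian (Biharmonic.opT k f) (Biharmonic.opSLap k f) ∧
    Biharmonic.IsWeakSolution lam f (Biharmonic.opT k f) := by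
  open Biharmonic in
  have hp0 : 0 < p := by linarith
  have hp_inv : 1 / p ≤ 1 := by rw [div_le_one hp0]; exact hp_one
  have hp_inv' : 1 / 2 ≤ 1 / p := one_div_le_one_div_of_le hp0 hp_upper
  -- The Young exponent for the target `L²`: `1/p + 1/q = 1 + 1/2`.
  set q : ℝ := 1 / (3 / 2 - 1 / p) with hq
  have hq_inv : 1 / q = 3 / 2 - 1 / p := by rw [hq, one_div_one_div]
  have hq_one : 1 ≤ q := by
    rw [hq, le_div_iff₀ (by linarith)]; linarith
  -- After substituting `1/q`, this reads `N/p < (N + 4)/2`, that is, `p > 2N/(N+4)`.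
  have hqN : (N : ℝ) / 2 - N / (2 * q) < 1 := by
    have hN0 : (0 : ℝ) < N := by exact_mod_cast hN
    have h1 : (N : ℝ) / (2 * q) = N / 2 * (1 / q) := by field_simp
    have h2 : 1 / p < (N + 4) / (2 * N) := by
      rw [div_lt_div_iff₀ hp0 (by positivity)]
      rw [div_lt_iff₀ (by positivity)] at hp_lower
      linarith
    have h3 : (N : ℝ) * (1 / p) < (N + 4) / 2 := by
      calc (N : ℝ) * (1 / p) < N * ((N + 4) / (2 * N)) := by gcongr
        _ = (N + 4) / 2 := by field_simp
    rw [h1, hq_inv]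
    linarith
  have hGm := (integrable_greenFn (N := N) hk).1
  have hDm := (integrable_laplacian_greenFn hN hk).1
  have hPm := fun i => (integrable_partialDeriv_greenFn hN hk i).1
  have hG : ∫⁻ x, absConv f (greenFn k) x ^ (2 : ℝ) < ⊤ :=
    lintegral_absConv_rpow_lt_top hp_one hq_one one_le_two (by rw [hq_inv]; ring) hf
      (memLp_greenFn hk hq_one hqN)
  have hD : ∫⁻ x, absConv f (Δ (greenFn k)) x ^ (2 : ℝ) < ⊤ :=
    lintegral_absConv_rpow_lt_top hp_one hq_one one_le_two (by rw [hq_inv]; ring) hf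
      (memLp_laplacian_greenFn hN hk hq_one hqN)
  -- Young's inequality with an `L¹` kernel, so the target exponent is `p` itself.
  have hP : ∀ i, ∫⁻ x, absConv f (partialDeriv i (greenFn k)) x ^ p < ⊤ := fun i =>
    lintegral_absConv_rpow_lt_top hp_one le_rfl hp_one (by ring) hf
      (by simpa [memLp_one_iff_integrable] using integrable_partialDeriv_greenFn hN hk i)
  have hT2 : MemLp (opT k f) 2 := by
    rw [opT]
    simpa using memLp_conv one_le_two hf.1 hGm hG
  have hL2 : MemLp (opSLap k f) 2 := by
    rw [opSLap]
    simpa using memLp_conv one_le_two hf.1 hDm hD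
  have hWL : HasWeakLaplacian (opT k f) (opSLap k f) := by
    refine ⟨hT2.locallyIntegrable (by norm_num), hL2.locallyIntegrable (by norm_num),
      fun φ hφ => ?_⟩
    rw [hφ.laplacian]
    exact integral_opT_mul_laplacian hN hk hf.1 hG hD hφ.toSchwartz
  have hH2 : MemH2 (opT k f) :=
    memH2_of_laplacian hT2 hL2 (integral_opT_mul_laplacian hN hk hf.1 hG hD)
  refine ⟨isFundamentalSolution_greenFn hN hk, convExistsAE_of_absConv one_le_two hf.1 hGm hG,
    fun i => convExistsAE_of_absConv hp_one hf.1 (hPm i) (hP i),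
    convExistsAE_of_absConv one_le_two hf.1 hDm hD, hH2,
    fun i => hasWeakPartialDeriv_opT hN hk hf.1 hG hp_one i (hP i), hWL,
    hH2, opSLap k f, hL2, hWL, fun φ hφ => ?_⟩
  set ψ := hφ.toSchwartz with hψ
  obtain ⟨hfi, h⟩ := integral_opSLap_mul_laplacian hN hk hf.1 hG hD ψ
  have hi1 : Integrable fun x => opSLap k f x * Δ ψ x :=
    integrable_conv_mul one_le_two hf.1 hDm hD (Δ ψ).integrable
      (SchwartzMap.norm_le_seminorm ℝ (Δ ψ))
  have hi2 : Integrable fun x => k ^ 2 * (opT k f x * ψ x) :=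
    (integrable_conv_mul one_le_two hf.1 hGm hG ψ.integrable
      (SchwartzMap.norm_le_seminorm ℝ ψ)).const_mul _
  rw [← integral_const_mul, ← integral_add hi1 hi2, ← sub_eq_zero] at h
  have h' := integral_sub (hi1.add hi2) hfi
  simp only [Pi.add_apply] at h'
  rw [← h, ← h', hφ.laplacian, hlam]
  refine integral_congr_ae (Filter.Eventually.of_forall fun x => ?_)
  simp only [hψ, hφ.coe_toSchwartz]
  ring
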